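/- (Lev's Structure Theorem) Let $G$ be a nonzero abelian group. For subsets $X,Y\subseteq G$ and $c\in G$ put $X+Y=\{x+y : x\in X,\ y\in Y\}$ and $c-X=\{c-x : x\in X\}$. A set $X\subseteq G$ is called aperiodic if $\{g\in G : X+g=X\}=\{0\}$. For a subgroup $H$ of $G$, a set $X\subseteq G$ is called $H$-quasi-periodic if there is $x\in G$ such that $(X\setminus(x+H))+H=X\setminus(x+H)$. A pair $\{X,Y\}$ of finite nonempty subsets of an abelian group $K$ is called a weak pair if at least one of the following conditions holds: (WP1) $\min(|X|,|Y|)=1$; (WP2) there is $d\in K$, of (possibly infinite) order at least $|X|+|Y|-1$, such that $X$ and $Y$ are both arithmetic progressions with difference $d$; (WP3) $X$ is aperiodic in $K$ and there are a finite subgroup $F$ of $K$ and $g\in K$ such that each of $X$ and $Y$ is contained in a coset of $F$ and $g-Y$ is the complement of $X$ in the coset of $F$ containing $X$; (WP4) there is a finite subgroup $F$ of $K$ such that each of $X$ and $Y$ is contained in a coset of $F$ and $|X|+|Y|=|F|+1$, and moreover there is $c\in K$ with $|(c-X)\cap Y|=1$. Let $A$ and $B$ be finite nonempty subsets of $G$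 with $|A|\le |B|$ and $|A+B|=|A|+|B|-1$. Suppose that either $A+B$ is aperiodic or there is $c\in G$ with $|(c-A)\cap B|=1$. Then there is a finite proper subgroup $H$ of $G$ (that is, $H\neq G$; $H=\{0\}$ is allowed) such that $A$ and $B$ are $H$-quasi-periodic and $\{\phi(A),\phi(B)\}$ is a weak pair in $G/H$, where $\phi:G\to G/H$ is the canonical morphism. -/

import Mathlib

open scoped Pointwise

/-- The period of a subset `A` of an abelian group, that is `{x | A + x = A}`, is
Mathlib's `AddAction.stabilizer G A`. The set `A` is aperiodic if its period is `{0}`. -/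
def IsAperiodicSet {G : Type*} [AddCommGroup G] (A : Set G) : Prop :=
  AddAction.stabilizer G A = ⊥

/-- `A` is `H`-quasi-periodic: for some `x`, the set `A \ (x + H)` is a (possibly empty) union
of cosets of `H`. -/
def IsQuasiPeriodic {G : Type*} [AddCommGroup G] (H : AddSubgroup G) (A : Set G) : Prop :=
  ∃ x : G, (A \ (x +ᵥ (H : Set G))) + (H : Set G) = A \ (x +ᵥ (H : Set G))

/-- `A` is a (finite) arithmetic progression with difference `d`:
`A = {a, a + d, …, a + (|A| - 1) d}` for some `a`. -/
def IsArithProgression {G : Type*} [AddCommGroup G] (d : G) (A : Set G) : Prop :=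
  ∃ a : G, A = {x | ∃ i : ℕ, i < A.ncard ∧ x = a + i • d}

/-- Some `c` has exactly one representation `c = a + b` with `a ∈ A`, `b ∈ B`, that is
`|(c - A) ∩ B| = 1`. -/
def HasUniqueSum {G : Type*} [AddCommGroup G] (A B : Set G) : Prop :=
  ∃ c : G, ((({c} : Set G) - A) ∩ B).ncard = 1

/-- Condition (WP1). -/
def WeakPair1 {G : Type*} [AddCommGroup G] (A B : Set G) : Prop :=
  min A.ncard B.ncard = 1

/-- Condition (WP2). Mathlib's `addOrderOf d` is `0` when `d` has infinite order. -/
def WeakPair2 {G : Type*} [AddCommGroup G] (A B : Set G) : Prop :=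
  ∃ d : G, (addOrderOf d = 0 ∨ A.ncard + B.ncard - 1 ≤ addOrderOf d) ∧
    IsArithProgression d A ∧ IsArithProgression d B

/-- Condition (WP3): `A` is aperiodic, `A` and `B` lie in cosets `a + H` and `b + H` of a finite
subgroup `H`, and `g - B` is the complement of `A` in its coset `a + H`. -/
def WeakPair3 {G : Type*} [AddCommGroup G] (A B : Set G) : Prop :=
  IsAperiodicSet A ∧
    ∃ H : AddSubgroup G, Finite H ∧ ∃ a b g : G,
      A ⊆ a +ᵥ (H : Set G) ∧ B ⊆ b +ᵥ (H : Set G) ∧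
        ({g} : Set G) - B = (a +ᵥ (H : Set G)) \ A

/-- Condition (WP4). The subgroup is necessarily finite, because of its cardinality. -/
def WeakPair4 {G : Type*} [AddCommGroup G] (A B : Set G) : Prop :=
  ∃ H : AddSubgroup G, Finite H ∧
    (∃ a b : G, A ⊆ a +ᵥ (H : Set G) ∧ B ⊆ b +ᵥ (H : Set G)) ∧
      A.ncard + B.ncard = Nat.card H + 1 ∧ HasUniqueSum A B

/-- `{A, B}` is a weak pair (for finite sets `A`, `B`). -/
def IsWeakPair {G : Type*} [AddCommGroup G] (A B : Set G) : Prop :=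
  WeakPair1 A B ∨ WeakPair2 A B ∨ WeakPair3 A B ∨ WeakPair4 A B

/-! For fixed A put d(Y) = |A| + |Y| - |A + Y| (`dfc`). Since A + (X ∩ Y) lies in (A + X) ∩ (A + Y),
d is supermodular (`dfc_add_dfc_le`), and Kneser's theorem bounds d(Y) by d(S), where S is the
stabilizer of A + Y.

The theorem is an induction over quotients. A reduction `Red H A B a b` by a proper nonzero H makes
the images of A and B in G/H a smaller critical pair in which the image of (a, b) is a unique sum.
To compose quasi-periodicity along successive quotients, later reductions must sit at this same base
point; `UniqueSum.reducible_of_reducible` moves them there.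

It remains to identify irreducible pairs. A one-element set gives (WP1). A unique sum with A + B = G
gives (WP4), and a unique sum in a periodic A + B ≠ G always yields a reduction by equality in
Kneser's inequality. If A + B is aperiodic and misses one point, the pair satisfies (WP3). The core
is the case where A + B is aperiodic, misses two points, and has no reduction (`Crit`): both sets
are progressions.

For that case, `Crit.subgroup_nonpos` shows d(R) ≤ 0 for every finite nonzero subgroup R with A + R
≠ G. When A + B + R ≠ G this follows by completing R-cosets of B one at a time. Otherwise G is
finite, and one uses also the dual set C = -(G \ (A + B)), for which (A, C) is critical too. Then
the isoperimetric method applies: a smallest deficient set M meets each of its other translates at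
most once. If |M| ≥ 3, then M can replace A, and a smallest deficient set N for M would satisfy both
|M| < |N| and |N| < |M|. Hence |M| = 2, so A is a progression, and growth of B + {0, d, ..., kd}
makes B one as well. -/

set_option linter.unusedSectionVars false

/-! ### Finite subgroups, cosets and periodic sets -/

namespace LevStructure

open Finset

variable {G : Type*} [AddCommGroup G] [DecidableEq G]

/-- A finite subgroup, as a `Finset`. -/
structure FinSub (T : Finset G) : Prop where
  zero : 0 ∈ T
  add : ∀ {x y}, x ∈ T → y ∈ T → x + y ∈ T
  neg : ∀ {x}, x ∈ T → -x ∈ T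

/-- The coset `b + R`. -/
def coset (R : Finset G) (b : G) : Finset G := R.image (b + ·)

/-- `X` is a union of cosets of `T`. -/
def Per (T X : Finset G) : Prop := ∀ t ∈ T, ∀ x ∈ X, t + x ∈ X

/-- No nonzero element translates `X` into itself. -/
def Aper (X : Finset G) : Prop := ∀ g, (∀ x ∈ X, g + x ∈ X) → g = 0

theorem mem_coset {R : Finset G} {b x : G} : x ∈ coset R b ↔ x - b ∈ R := by
  simp only [coset, mem_image]
  constructor
  · rintro ⟨r, hr, rfl⟩
    simpa using hr
  · intro h
    exact ⟨_, h, by abel⟩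

theorem card_coset (R : Finset G) (b : G) : (coset R b).card = R.card :=
  card_image_of_injective _ (add_right_injective b)

namespace FinSub

variable {T : Finset G}

theorem sub (hT : FinSub T) {x y : G} (hx : x ∈ T) (hy : y ∈ T) : x - y ∈ T := by
  rw [sub_eq_add_neg]
  exact hT.add hx (hT.neg hy)

theorem card_pos (hT : FinSub T) : 0 < T.card := Finset.card_pos.2 ⟨0, hT.zero⟩

theorem self_mem_coset (hT : FinSub T) (b : G) : b ∈ coset T b := by
  simpa [mem_coset] using hT.zero

theorem coset_comm (hT : FinSub T) {a b : G} (h : a ∈ coset T b) : b ∈ coset T a := by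
  rw [mem_coset] at h ⊢
  simpa using hT.neg h

theorem coset_trans (hT : FinSub T) {a b c : G} (h : a ∈ coset T b) (h' : b ∈ coset T c) :
    a ∈ coset T c := by
  rw [mem_coset] at *
  simpa using hT.add h h'

theorem coset_eq (hT : FinSub T) {a b : G} (h : a ∈ coset T b) : coset T a = coset T b := by
  ext x
  exact ⟨fun hx => hT.coset_trans hx h, fun hx => hT.coset_trans hx (hT.coset_comm h)⟩

theorem per_coset (hT : FinSub T) (b : G) : Per T (coset T b) := by
  intro t ht x hx
  rw [mem_coset] at *
  rw [add_sub_assoc]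
  exact hT.add ht hx

theorem per_self (hT : FinSub T) : Per T T := fun _ ht _ hx => hT.add ht hx

theorem inter {S : Finset G} (hT : FinSub T) (hS : FinSub S) : FinSub (T ∩ S) where
  zero := by simp [hT.zero, hS.zero]
  add hx hy := by
    rw [mem_inter] at *
    exact ⟨hT.add hx.1 hy.1, hS.add hx.2 hy.2⟩
  neg hx := by
    rw [mem_inter] at *
    exact ⟨hT.neg hx.1, hS.neg hx.2⟩

theorem bot : FinSub ({0} : Finset G) where
  zero := by simp
  add hx hy := by simp_all
  neg hx := by simp_all

theorem exists_ne_zero (hT : FinSub T) (h : T ≠ {0}) : ∃ t ∈ T, t ≠ 0 := by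
  by_contra! hc
  exact h (eq_singleton_iff_unique_mem.2 ⟨hT.zero, hc⟩)

theorem two_le_card (hT : FinSub T) (h : T ≠ {0}) : 2 ≤ T.card := by
  obtain ⟨t, ht, h0⟩ := hT.exists_ne_zero h
  exact Finset.one_lt_card.2 ⟨t, ht, 0, hT.zero, h0⟩

end FinSub

theorem add_coset (A R : Finset G) (b : G) : A + coset R b = (A + R).image (b + ·) := by
  ext x
  simp only [mem_add, coset, mem_image]
  constructor
  · rintro ⟨a, ha, _, ⟨r, hr, rfl⟩, rfl⟩
    exact ⟨a + r, ⟨a, ha, r, hr, rfl⟩, by abel⟩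
  · rintro ⟨_, ⟨a, ha, r, hr, rfl⟩, rfl⟩
    exact ⟨a, ha, _, ⟨r, hr, rfl⟩, by abel⟩

section Per

variable {T X Y : Finset G}

theorem Per.mono {S : Finset G} (h : Per T X) (hS : S ⊆ T) : Per S X :=
  fun t ht x hx => h t (hS ht) x hx

theorem Per.add_eq (hT : FinSub T) (h : Per T X) : X + T = X := by
  apply Subset.antisymm
  · intro z hz
    obtain ⟨x, hx, t, ht, rfl⟩ := mem_add.1 hz
    rw [add_comm]
    exact h t ht x hx
  · intro x hx
    exact mem_add.2 ⟨x, hx, 0, hT.zero, add_zero x⟩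

theorem subset_add (hT : FinSub T) : X ⊆ X + T :=
  fun x hx => mem_add.2 ⟨x, hx, 0, hT.zero, add_zero x⟩

theorem per_add (hT : FinSub T) (X : Finset G) : Per T (X + T) := by
  intro t ht z hz
  obtain ⟨x, hx, s, hs, rfl⟩ := mem_add.1 hz
  exact mem_add.2 ⟨x, hx, t + s, hT.add ht hs, by abel⟩

theorem Per.add_left (h : Per T X) (Y : Finset G) : Per T (X + Y) := by
  intro t ht z hz
  obtain ⟨x, hx, y, hy, rfl⟩ := mem_add.1 hz
  exact mem_add.2 ⟨t + x, h t ht x hx, y, hy, by abel⟩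

theorem Per.add_right (h : Per T Y) (X : Finset G) : Per T (X + Y) := by
  rw [add_comm]
  exact h.add_left X

theorem Per.union (h : Per T X) (h' : Per T Y) : Per T (X ∪ Y) := by
  intro t ht z hz
  rw [mem_union] at *
  exact hz.imp (h t ht z) (h' t ht z)

theorem Per.sdiff (hT : FinSub T) (h : Per T X) (h' : Per T Y) : Per T (X \ Y) := by
  intro t ht z hz
  rw [mem_sdiff] at *
  refine ⟨h t ht z hz.1, fun hc => hz.2 ?_⟩
  simpa using h' (-t) (hT.neg ht) _ hc

theorem Per.coset_subset (h : Per T X) {x : G} (hx : x ∈ X) : coset T x ⊆ X := by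
  intro y hy
  rw [mem_coset] at hy
  simpa using h _ hy x hx

theorem per_of_card_le (hT : FinSub T) (h : (X + T).card ≤ X.card) : Per T X := by
  rw [eq_of_subset_of_card_le (subset_add hT) h]
  exact per_add hT X

theorem card_le_card_add (hT : FinSub T) (X : Finset G) : X.card ≤ (X + T).card :=
  card_le_card (subset_add hT)

theorem coset_subset_add {x : G} (hx : x ∈ X) : coset T x ⊆ X + T := by
  intro y hy
  rw [mem_coset] at hy
  exact mem_add.2 ⟨x, hx, _, hy, by abel⟩

theorem two_mul_card_le (hT : FinSub T) {x y : G} (hx : x ∈ X) (hy : y ∈ X)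
    (hxy : y ∉ coset T x) : 2 * T.card ≤ (X + T).card := by
  have hd : Disjoint (coset T x) (coset T y) := by
    rw [disjoint_left]
    intro z hz hz'
    exact hxy (hT.coset_trans (hT.coset_comm hz') hz)
  have := card_le_card (union_subset (coset_subset_add (T := T) hx) (coset_subset_add hy))
  rw [card_union_of_disjoint hd, card_coset, card_coset] at this
  omega

theorem card_sdiff_coset_add (hT : FinSub T) {a : G} (ha : a ∈ X) :
    (X + T).card = ((X \ coset T a) + T).card + T.card := by
  have : X + T = ((X \ coset T a) + T) ∪ coset T a := by
    ext z
    constructor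
    · intro hz
      obtain ⟨x, hx, t, ht, rfl⟩ := mem_add.1 hz
      by_cases h : x ∈ coset T a
      · refine mem_union_right _ ?_
        rw [mem_coset] at *
        rw [add_sub_right_comm]
        exact hT.add h ht
      · exact mem_union_left _ (mem_add.2 ⟨x, mem_sdiff.2 ⟨hx, h⟩, t, ht, rfl⟩)
    · intro hz
      rcases mem_union.1 hz with h | h
      · exact add_subset_add_right sdiff_subset h
      · exact coset_subset_add ha h
  rw [this, card_union_of_disjoint, card_coset]
  rw [disjoint_left]
  intro z hz hz'
  obtain ⟨x, hx, t, ht, rfl⟩ := mem_add.1 hz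
  refine (mem_sdiff.1 hx).2 (hT.coset_trans ?_ hz')
  rw [mem_coset]
  simpa using hT.neg ht

end Per

/-- The stabilizer of a finite set, as a `Finset`. -/
def stab (X : Finset G) : Finset G := (X - X).filter fun g => ∀ x ∈ X, g + x ∈ X

theorem mem_stab {X : Finset G} (hX : X.Nonempty) {g : G} :
    g ∈ stab X ↔ ∀ x ∈ X, g + x ∈ X := by
  simp only [stab, mem_filter, and_iff_right_iff_imp]
  intro h
  obtain ⟨x, hx⟩ := hX
  exact mem_sub.2 ⟨_, h x hx, x, hx, by abel⟩

theorem finSub_stab {X : Finset G} (hX : X.Nonempty) : FinSub (stab X) where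
  zero := by simp [mem_stab hX]
  add {g h} hg hh := by
    rw [mem_stab hX] at *
    intro x hx
    rw [add_assoc]
    exact hg _ (hh x hx)
  neg {g} hg := by
    rw [mem_stab hX] at *
    intro x hx
    have him : X.image (g + ·) = X :=
      eq_of_subset_of_card_le (image_subset_iff.2 hg)
        (card_image_of_injective _ (add_right_injective g)).ge
    rw [← him, mem_image] at hx
    obtain ⟨y, hy, rfl⟩ := hx
    simpa using hy

theorem per_stab {X : Finset G} : Per (stab X) X := by
  intro g hg
  rw [stab, mem_filter] at hg
  exact hg.2

theorem Aper.eq_bot {T X : Finset G} (h : Aper X) (hT : FinSub T) (hp : Per T X) : T = {0} :=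
  eq_singleton_iff_unique_mem.2 ⟨hT.zero, fun t ht => h t (hp t ht)⟩

/-! ### Kneser's theorem -/

section Kneser

variable {S₁ S₂ C₁ C₂ : Finset G}

/-- If `d + x ∉ C₂` and `d + y ∈ C₁`, then `d + x + y` is in `C₁` by `S₁`-periodicity and outside
`C₂` by `S₂`-periodicity. Pairs with equal sums differ by an element of `S₁ ∩ S₂`. -/
theorem grid_card_le (h₁ : FinSub S₁) (h₂ : FinSub S₂) (p₁ : Per S₁ C₁) (p₂ : Per S₂ C₂) (d : G) :
    (S₁.card - (S₁.filter (d + · ∈ C₂)).card) * (S₂.filter (d + · ∈ C₁)).card ≤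
      (S₁ ∩ S₂).card * (C₁ \ C₂).card := by
  have e : S₁.card - (S₁.filter (d + · ∈ C₂)).card = (S₁.filter (d + · ∉ C₂)).card := by
    have := card_filter_add_card_filter_not (s := S₁) (d + · ∈ C₂)
    omega
  rw [e, ← card_product]
  refine card_le_mul_card_image_of_maps_to (f := fun p => d + p.1 + p.2) ?_ _ ?_
  · rintro ⟨x, y⟩ hxy
    simp only [mem_product, mem_filter, mem_sdiff] at hxy ⊢
    constructor
    · rw [show d + x + y = x + (d + y) by abel]
      exact p₁ _ hxy.1.1 _ hxy.2.2
    · intro hc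
      have := p₂ _ (h₂.neg hxy.2.1) _ hc
      rw [show -y + (d + x + y) = d + x by abel] at this
      exact hxy.1.2 this
  · intro b _
    rcases (filter (fun p : G × G => d + p.1 + p.2 = b) (filter (d + · ∉ C₂) S₁ ×ˢ
      filter (d + · ∈ C₁) S₂)).eq_empty_or_nonempty with h | ⟨⟨x₀, y₀⟩, h⟩
    · rw [h]; simp
    · simp only [mem_filter, mem_product] at h
      refine card_le_card_of_injOn (fun p => p.1 - x₀) ?_ ?_
      · rintro ⟨x, y⟩ hxy
        simp only [coe_filter, mem_product, mem_filter, Set.mem_ofPred_eq, coe_inter,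
          Set.mem_inter_iff, mem_coe] at hxy ⊢
        refine ⟨h₁.sub hxy.1.1.1 h.1.1.1, ?_⟩
        have e2 : x - x₀ = y₀ - y := by
          have := hxy.2.trans h.2.symm
          have h3 : x + y = x₀ + y₀ := by
            simpa [add_assoc] using this
          rw [sub_eq_sub_iff_add_eq_add, h3, add_comm]
        rw [e2]
        exact h₂.sub h.1.2.1 hxy.1.2.1
      · rintro ⟨x, y⟩ hxy ⟨x', y'⟩ hxy' hE
        simp only [coe_filter, mem_product, mem_filter, Set.mem_ofPred_eq] at hxy hxy' hE
        have hx : x = x' := by simpa using hE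
        subst hx
        have := hxy.2.trans hxy'.2.symm
        simpa using this

/-- The filtered set is a union of cosets of `S₁ ∩ S₂`. -/
theorem inter_card_le_filter (h₂ : FinSub S₂) (p₁ : Per S₁ C₁) (d : G)
    (hne : (S₂.filter (d + · ∈ C₁)).Nonempty) :
    (S₁ ∩ S₂).card ≤ (S₂.filter (d + · ∈ C₁)).card := by
  obtain ⟨y, hy⟩ := hne
  rw [mem_filter] at hy
  refine card_le_card_of_injOn (· + y) ?_ (fun a _ b _ h => by simpa using h)
  intro s hs
  simp only [coe_inter, Set.mem_inter_iff, mem_coe, coe_filter, Set.mem_ofPred_eq] at hs ⊢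
  refine ⟨h₂.add hs.2 hy.1, ?_⟩
  rw [show d + (s + y) = s + (d + y) by abel]
  exact p₁ _ hs.1 _ hy.2

theorem inter_card_le_filter_not (h₁ : FinSub S₁) (h₂ : FinSub S₂) (p₁ : Per S₁ C₁) (d : G)
    (hne : (S₂.filter (d + · ∉ C₁)).Nonempty) :
    (S₁ ∩ S₂).card ≤ (S₂.filter (d + · ∉ C₁)).card := by
  obtain ⟨y, hy⟩ := hne
  rw [mem_filter] at hy
  refine card_le_card_of_injOn (· + y) ?_ (fun a _ b _ h => by simpa using h)
  intro s hs
  simp only [coe_inter, Set.mem_inter_iff, mem_coe, coe_filter, Set.mem_ofPred_eq] at hs ⊢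
  refine ⟨h₂.add hs.2 hy.1, fun hc => hy.2 ?_⟩
  have := p₁ _ (h₁.neg hs.1) _ hc
  rwa [show -s + (d + (s + y)) = d + y by abel] at this

/-- When neither set contains the other, exchanging their roles gives two opposite strict
inequalities. -/
theorem card_lt_of_mem_sdiff (h₁ : FinSub S₁) (h₂ : FinSub S₂) (p₁ : Per S₁ C₁) (p₂ : Per S₂ C₂)
    (c₁ : (C₂ \ C₁).card + (S₁ ∩ S₂).card < S₁.card)
    (c₂ : (C₁ \ C₂).card + (S₁ ∩ S₂).card < S₂.card) {d : G} (hd : d ∈ C₂ \ C₁) :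
    S₂.card < S₁.card := by
  rw [mem_sdiff] at hd
  have g₁ := grid_card_le h₁ h₂ p₁ p₂ d
  have g₂ := grid_card_le h₂ h₁ p₂ p₁ d
  have a₁ := inter_card_le_filter h₂ p₁ d
  have a₂ := inter_card_le_filter h₁ p₂ d ⟨0, by simp [h₁.zero, hd.1]⟩
  have b₁ := inter_card_le_filter_not h₁ h₂ p₁ d ⟨0, by simp [h₂.zero, hd.2]⟩
  have b₂ := inter_card_le_filter_not h₂ h₁ p₂ d
  have s₁ := card_filter_add_card_filter_not (s := S₂) (d + · ∈ C₁)
  have s₂ := card_filter_add_card_filter_not (s := S₁) (d + · ∈ C₂)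
  rw [inter_comm S₂ S₁] at g₂ a₂ b₂
  rw [← card_pos] at a₁ b₂
  have hk : 0 < (S₁ ∩ S₂).card := (h₁.inter h₂).card_pos
  rw [show S₁.card - (S₁.filter (d + · ∈ C₂)).card = (S₁.filter (d + · ∉ C₂)).card by omega] at g₁
  rw [show S₂.card - (S₂.filter (d + · ∈ C₁)).card = (S₂.filter (d + · ∉ C₁)).card by omega] at g₂
  generalize (S₁ ∩ S₂).card = k at *
  generalize (S₂.filter (d + · ∈ C₁)).card = u at *
  generalize (S₂.filter (d + · ∉ C₁)).card = y at *
  generalize (S₁.filter (d + · ∈ C₂)).card = v at *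
  generalize (S₁.filter (d + · ∉ C₂)).card = x at *
  generalize (C₂ \ C₁).card = e at *
  generalize (C₁ \ C₂).card = f at *
  -- Here |S₂| = u + y, |S₁| = v + x, x u ≤ k f and y v ≤ k e. If u and x are nonzero, all four
  -- counts are at least k, and (k + p)(k + q) ≥ k (k + p + q) contradicts one of the assumed bounds
  -- on e and f.
  by_contra hlt
  rcases Nat.eq_zero_or_pos u with hu | hu
  · subst hu
    have : y * k ≤ k * e := (Nat.mul_le_mul_left y a₂).trans g₂
    have : y ≤ e := by nlinarith
    omega
  have a₁ := a₁ hu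
  rcases Nat.eq_zero_or_pos x with hx | hx
  · subst hx
    have : k * v ≤ k * e := (Nat.mul_le_mul_right v b₁).trans g₂
    have : v ≤ e := by nlinarith
    omega
  have b₂ := b₂ hx
  rcases le_total y x with hyx | hyx
  · have h3 : y * u ≤ x * u := Nat.mul_le_mul_right u hyx
    have h4 : k * f < k * (y + u - k) := Nat.mul_lt_mul_of_pos_left (by omega) hk
    obtain ⟨p, rfl⟩ := Nat.exists_eq_add_of_le b₁
    obtain ⟨q, rfl⟩ := Nat.exists_eq_add_of_le a₁
    rw [show k + p + (k + q) - k = k + p + q by omega] at h4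
    nlinarith
  · have h3 : x * v ≤ y * v := Nat.mul_le_mul_right v hyx
    have h4 : k * e < k * (x + v - k) := Nat.mul_lt_mul_of_pos_left (by omega) hk
    obtain ⟨p, rfl⟩ := Nat.exists_eq_add_of_le b₂
    obtain ⟨q, rfl⟩ := Nat.exists_eq_add_of_le a₂
    rw [show k + p + (k + q) - k = k + p + q by omega] at h4
    nlinarith

/-- The union of two periodic sets that are large relative to their periods has this property. -/
theorem exists_period_union {n : ℕ} (h₁ : FinSub S₁) (h₂ : FinSub S₂) (p₁ : Per S₁ C₁)
    (p₂ : Per S₂ C₂) (n₁ : n ≤ C₁.card + S₁.card) (n₂ : n ≤ C₂.card + S₂.card) :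
    ∃ S, FinSub S ∧ Per S (C₁ ∪ C₂) ∧ n ≤ (C₁ ∪ C₂).card + S.card := by
  by_cases s₁ : C₂ ⊆ C₁
  · exact ⟨S₁, h₁, by rwa [union_eq_left.2 s₁], by rwa [union_eq_left.2 s₁]⟩
  by_cases s₂ : C₁ ⊆ C₂
  · exact ⟨S₂, h₂, by rwa [union_eq_right.2 s₂], by rwa [union_eq_right.2 s₂]⟩
  refine ⟨S₁ ∩ S₂, h₁.inter h₂, (p₁.mono inter_subset_left).union (p₂.mono inter_subset_right), ?_⟩
  obtain ⟨d, hd, hd'⟩ := not_subset.1 s₁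
  obtain ⟨e, he, he'⟩ := not_subset.1 s₂
  have u₁ := card_sdiff_add_card C₂ C₁
  have u₂ := card_sdiff_add_card C₁ C₂
  rw [union_comm] at u₁
  by_contra hc
  have c₁ : (C₂ \ C₁).card + (S₁ ∩ S₂).card < S₁.card := by omega
  have c₂ : (C₁ \ C₂).card + (S₁ ∩ S₂).card < S₂.card := by omega
  have l₁ := card_lt_of_mem_sdiff h₁ h₂ p₁ p₂ c₁ c₂ (mem_sdiff.2 ⟨hd, hd'⟩)
  have l₂ := card_lt_of_mem_sdiff h₂ h₁ p₂ p₁ (by rwa [inter_comm]) (by rwa [inter_comm])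
    (mem_sdiff.2 ⟨he, he'⟩)
  omega

/-- Dyson's transform: (A ∪ (e + B), B ∩ (A - e)) has the same total size and its sumset stays
inside A + B. It shrinks B as long as A + B ⊄ A; at the end B lies in the stabilizer of A. -/
theorem exists_period_subset_zero (n : ℕ) : ∀ A B : Finset G, B.card = n → 0 ∈ A → 0 ∈ B →
    ∃ C S, C ⊆ A + B ∧ 0 ∈ C ∧ FinSub S ∧ Per S C ∧ A.card + B.card ≤ C.card + S.card := by
  induction n using Nat.strong_induction_on with
  | _ n ih =>
    intro A B hn hA hB
    by_cases h : A + B ⊆ A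
    · refine ⟨A, stab A, fun a ha => mem_add.2 ⟨a, ha, 0, hB, add_zero a⟩, hA,
        finSub_stab ⟨0, hA⟩, per_stab, Nat.add_le_add_left (card_le_card ?_) _⟩
      intro b hb
      rw [mem_stab ⟨0, hA⟩]
      intro a ha
      rw [add_comm]
      exact h (add_mem_add ha hb)
    · obtain ⟨z, hz, hzA⟩ := not_subset.1 h
      obtain ⟨e, he, b, hb, rfl⟩ := mem_add.1 hz
      have hcard : (A ∪ B.image (e + ·)).card + (B.filter (e + · ∈ A)).card = A.card + B.card := by
        have h5 := card_union_add_card_inter A (B.image (e + ·))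
        rw [card_image_of_injective B (add_right_injective e)] at h5
        have : (B.filter (e + · ∈ A)).image (e + ·) = A ∩ B.image (e + ·) := by
          ext x
          simp only [mem_image, mem_filter, mem_inter]
          constructor
          · rintro ⟨y, hy, rfl⟩
            exact ⟨hy.2, y, hy.1, rfl⟩
          · rintro ⟨hx, y, hy, rfl⟩
            exact ⟨y, ⟨hy, hx⟩, rfl⟩
        have h6 := card_image_of_injective (B.filter (e + · ∈ A)) (add_right_injective e)
        rw [this] at h6
        omega
      have hlt : (B.filter (e + · ∈ A)).card < n := by
        rw [← hn]
        apply card_lt_card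
        rw [ssubset_iff_of_subset (filter_subset _ _)]
        exact ⟨b, hb, by simp [hzA]⟩
      obtain ⟨C, S, hC, h0, hS, hp, hle⟩ := ih _ hlt (A ∪ B.image (e + ·)) (B.filter (e + · ∈ A))
        rfl (mem_union_left _ hA) (by simp [hB, he])
      refine ⟨C, S, hC.trans ?_, h0, hS, hp, by omega⟩
      intro x hx
      obtain ⟨y, hy, w, hw, rfl⟩ := mem_add.1 hx
      rw [mem_filter] at hw
      rcases mem_union.1 hy with hy | hy
      · exact add_mem_add hy hw.1
      · obtain ⟨v, hv, rfl⟩ := mem_image.1 hy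
        rw [show e + v + w = (e + w) + v by abel]
        exact add_mem_add hw.2 hv

theorem exists_period_subset {A B : Finset G} {a b : G} (ha : a ∈ A) (hb : b ∈ B) :
    ∃ C S, C ⊆ A + B ∧ a + b ∈ C ∧ FinSub S ∧ Per S C ∧ A.card + B.card ≤ C.card + S.card := by
  obtain ⟨C, S, hC, h0, hS, hp, hle⟩ := exists_period_subset_zero _ (A.image (-a + ·))
    (B.image (-b + ·)) rfl (mem_image.2 ⟨a, ha, by simp⟩) (mem_image.2 ⟨b, hb, by simp⟩)
  rw [card_image_of_injective A (add_right_injective _),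
    card_image_of_injective B (add_right_injective _)] at hle
  refine ⟨C.image (a + b + ·), S, ?_, mem_image.2 ⟨0, h0, by simp⟩, hS, ?_, ?_⟩
  · intro x hx
    obtain ⟨c, hc, rfl⟩ := mem_image.1 hx
    obtain ⟨y, hy, z, hz, rfl⟩ := mem_add.1 (hC hc)
    obtain ⟨y', hy', rfl⟩ := mem_image.1 hy
    obtain ⟨z', hz', rfl⟩ := mem_image.1 hz
    rw [show a + b + (-a + y' + (-b + z')) = y' + z' by abel]
    exact add_mem_add hy' hz'
  · intro t ht x hx
    obtain ⟨c, hc, rfl⟩ := mem_image.1 hx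
    exact mem_image.2 ⟨t + c, hp t ht c hc, by abel⟩
  · rwa [card_image_of_injective C (add_right_injective _)]

/-- The sets that `exists_period_subset` supplies for single sums are glued one by one with
`exists_period_union`. -/
theorem exists_period_add {A B : Finset G} (hA : A.Nonempty) (hB : B.Nonempty) :
    ∃ S, FinSub S ∧ Per S (A + B) ∧ A.card + B.card ≤ (A + B).card + S.card := by
  have key : ∀ F : Finset G, F.Nonempty → F ⊆ A + B → ∃ C S, F ⊆ C ∧ C ⊆ A + B ∧ FinSub S ∧
      Per S C ∧ A.card + B.card ≤ C.card + S.card := by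
    intro F hF
    induction hF using Finset.Nonempty.cons_induction with
    | singleton z =>
      intro hz
      obtain ⟨a, ha, b, hb, rfl⟩ := mem_add.1 (hz (mem_singleton_self z))
      obtain ⟨C, S, hC, h0, hS, hp, hle⟩ := exists_period_subset ha hb
      exact ⟨C, S, by simpa using h0, hC, hS, hp, hle⟩
    | cons z F hzF _ ih =>
      intro hs
      rw [cons_eq_insert] at hs ⊢
      obtain ⟨C, S, hFC, hC, hS, hp, hle⟩ := ih ((subset_insert _ _).trans hs)
      obtain ⟨a, ha, b, hb, rfl⟩ := mem_add.1 (hs (mem_insert_self z F))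
      obtain ⟨C', S', hC', h0, hS', hp', hle'⟩ := exists_period_subset ha hb
      obtain ⟨S'', hS'', hp'', hle''⟩ := exists_period_union hS hS' hp hp' hle hle'
      refine ⟨C ∪ C', S'', ?_, union_subset hC hC', hS'', hp'', hle''⟩
      exact insert_subset (mem_union_right _ h0) (hFC.trans subset_union_left)
  obtain ⟨C, S, h1, h2, hS, hp, hle⟩ := key (A + B) (hA.add hB) Subset.rfl
  rw [Subset.antisymm h2 h1] at hp hle
  exact ⟨S, hS, hp, hle⟩

/-- Kneser's theorem. -/
theorem kneser {A B : Finset G} (hA : A.Nonempty) (hB : B.Nonempty) :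
    ∃ S, FinSub S ∧ Per S (A + B) ∧ (∀ g, (∀ x ∈ A + B, g + x ∈ A + B) → g ∈ S) ∧
      (A + S).card + (B + S).card ≤ (A + B).card + S.card := by
  have hne := hA.add hB
  have hP := finSub_stab hne
  refine ⟨stab (A + B), hP, per_stab, fun g hg => (mem_stab hne).2 hg, ?_⟩
  have hPne : (stab (A + B)).Nonempty := ⟨0, hP.zero⟩
  -- Adding the stabilizer to both summands keeps the sumset, so the period found here is contained
  -- in the stabilizer.
  obtain ⟨S, hS, hp, hle⟩ := exists_period_add (hA.add hPne) (hB.add hPne)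
  have e : A + stab (A + B) + (B + stab (A + B)) = A + B := by
    rw [add_add_add_comm, hP.per_self.add_eq hP, per_stab.add_eq hP]
  rw [e] at hp hle
  have : S ⊆ stab (A + B) := fun s hs => (mem_stab hne).2 (hp s hs)
  have := card_le_card this
  omega

end Kneser

/-! ### Deficiency -/

/-- The deficiency `|A| + |Y| - |A + Y|` of a pair of finite sets. -/
def dfc (A Y : Finset G) : ℤ := A.card + Y.card - (A + Y).card

theorem dfc_comm (A Y : Finset G) : dfc A Y = dfc Y A := by
  rw [dfc, dfc, add_comm A Y]
  ring

theorem dfc_coset (A R : Finset G) (b : G) : dfc A (coset R b) = dfc A R := by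
  rw [dfc, dfc, card_coset, add_coset, card_image_of_injective _ (add_right_injective b)]

theorem dfc_singleton (A : Finset G) (g : G) : dfc A {g} = 1 := by
  rw [dfc, add_singleton, card_vadd_finset]
  simp

theorem dfc_add_dfc_le (A X Y : Finset G) :
    dfc A X + dfc A Y ≤ dfc A (X ∩ Y) + dfc A (X ∪ Y) := by
  have h1 := card_union_add_card_inter X Y
  have h2 := card_union_add_card_inter (A + X) (A + Y)
  have h3 : (A + (X ∩ Y)).card ≤ ((A + X) ∩ (A + Y)).card := card_le_card add_inter_subset
  rw [← add_union] at h2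
  simp only [dfc]
  omega

/-- The equality case of `dfc_add_dfc_le`. -/
theorem inter_subset_of_dfc_le {A X Y : Finset G}
    (h : dfc A (X ∩ Y) + dfc A (X ∪ Y) ≤ dfc A X + dfc A Y) :
    (A + X) ∩ (A + Y) ⊆ A + (X ∩ Y) := by
  have h1 := card_union_add_card_inter X Y
  have h2 := card_union_add_card_inter (A + X) (A + Y)
  rw [← add_union] at h2
  simp only [dfc] at h
  refine (eq_of_subset_of_card_le (s := A + (X ∩ Y)) add_inter_subset ?_).ge
  omega

/-- Kneser's inequality rewritten: `dfc A Y` falls short of `dfc A S` by at least the number of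
points of `Y + S` missing from `Y`. -/
theorem exists_dfc_le {A Y : Finset G} (hA : A.Nonempty) (hY : Y.Nonempty) :
    ∃ S, FinSub S ∧ Per S (A + Y) ∧ (∀ g, (∀ x ∈ A + Y, g + x ∈ A + Y) → g ∈ S) ∧
      dfc A Y + (Y + S).card ≤ dfc A S + Y.card := by
  obtain ⟨S, hS, hp, hg, hle⟩ := kneser hA hY
  refine ⟨S, hS, hp, hg, ?_⟩
  simp only [dfc]
  omega

theorem dfc_le_one {A Y : Finset G} (hA : A.Nonempty) (hY : Y.Nonempty) (h : Aper (A + Y)) :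
    dfc A Y ≤ 1 := by
  obtain ⟨S, hS, hp, -, hle⟩ := exists_dfc_le hA hY
  have := h.eq_bot hS hp
  subst this
  rw [dfc_singleton] at hle
  have := card_le_card_add FinSub.bot Y
  omega

theorem dfc_le_stab {A Y S : Finset G} (hS : FinSub S)
    (h : dfc A Y + (Y + S).card ≤ dfc A S + Y.card) : dfc A Y ≤ dfc A S := by
  have := card_le_card_add hS Y
  omega

theorem dfc_le_card {A Y : Finset G} (hA : A.Nonempty) : dfc A Y ≤ A.card := by
  have := card_le_card_add_left (t := Y) hA
  simp only [dfc]
  omega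

theorem dfc_le_card' {A Y : Finset G} (hY : Y.Nonempty) : dfc A Y ≤ Y.card := by
  rw [dfc_comm]
  exact dfc_le_card hY

/-- How a part of a coset of `R` can have large deficiency. -/
theorem dfc_piece_cases {A Y R : Finset G} {b : G} (hA : A.Nonempty) (hY : Y.Nonempty)
    (hR : FinSub R) (hYR : Y ⊆ coset R b) :
    Aper (A + Y) ∨ dfc A Y ≤ 0 ∨ Y.card = 1 ∨
      ∃ S ⊆ R, FinSub S ∧ S ≠ {0} ∧ dfc A Y ≤ dfc A S ∧ (R ⊆ S → Per R (A + Y)) := by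
  obtain ⟨S, hS, hp, hg, hle⟩ := exists_dfc_le hA hY
  by_cases hS0 : S = {0}
  · left
    intro g hg'
    simpa [hS0] using hg g hg'
  right
  by_cases h1 : Y.card = 1
  · exact Or.inr (Or.inl h1)
  have h2 : 1 < Y.card := by
    have := hY.card_pos
    omega
  obtain ⟨u, hu, v, hv, huv⟩ := one_lt_card.1 h2
  have hsub : ∀ {x y}, x ∈ Y → y ∈ Y → x - y ∈ R := by
    intro x y hx hy
    have hx := mem_coset.1 (hYR hx)
    have hy := mem_coset.1 (hYR hy)
    simpa using hR.sub hx hy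
  -- Inside one coset of `S`, the period can be cut down to `S ∩ R`, which still contains all
  -- differences of `Y`.
  by_cases hone : Y ⊆ coset S u
  · right; right
    refine ⟨S ∩ R, inter_subset_right, hS.inter hR, ?_, ?_, fun h => hp.mono (h.trans inter_subset_left)⟩
    · intro h0
      have : v - u ∈ S ∩ R := mem_inter.2 ⟨mem_coset.1 (hone hv), hsub hv hu⟩
      rw [h0, mem_singleton, sub_eq_zero] at this
      exact huv this.symm
    · have hYc : Y.card ≤ (S ∩ R).card := by
        rw [← card_coset (S ∩ R) u]
        refine card_le_card fun y hy => mem_coset.2 (mem_inter.2 ⟨mem_coset.1 (hone hy), hsub hy hu⟩)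
      have hYS : Y + S = coset S u := by
        apply Subset.antisymm
        · rw [← (hS.per_coset u).add_eq hS]
          exact add_subset_add_right hone
        · exact coset_subset_add hu
      have h3 : (A + (S ∩ R)).card ≤ (A + S).card := card_le_card (add_subset_add_left inter_subset_left)
      rw [hYS, card_coset] at hle
      simp only [dfc] at hle ⊢
      omega
  · obtain ⟨w, hw, hwS⟩ := not_subset.1 hone
    have h4 := two_mul_card_le hS hu hw hwS
    by_cases hSR : S ⊆ R
    · exact Or.inr (Or.inr ⟨S, hSR, hS, hS0, dfc_le_stab hS hle, fun h => hp.mono h⟩)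
    · left
      obtain ⟨s, hs, hsR⟩ := not_subset.1 hSR
      -- Shifting by s ∈ S \ R moves Y off itself, so |Y + S| ≥ 2|Y|. With |Y + S| ≥ 2|S| this gives
      -- |Y + S| ≥ |Y| + |S|, and `dfc A S` is at most |S|.
      have key : ∀ y ∈ Y, y + s ∉ Y := fun y hy hys => hsR (by simpa using hsub hys hy)
      have h5 : 2 * Y.card ≤ (Y + S).card := by
        have hd : Disjoint Y (Y.image (· + s)) := by
          rw [disjoint_right]
          intro z hz
          obtain ⟨y, hy, rfl⟩ := mem_image.1 hz
          exact key y hy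
        have : Y ∪ Y.image (· + s) ⊆ Y + S := by
          refine union_subset (subset_add hS) ?_
          intro z hz
          obtain ⟨y, hy, rfl⟩ := mem_image.1 hz
          exact add_mem_add hy hs
        have := card_le_card this
        rw [card_union_of_disjoint hd, card_image_of_injective _ (add_left_injective s)] at this
        omega
      have h6 : dfc A S ≤ S.card := dfc_le_card' ⟨0, hS.zero⟩
      omega

theorem card_inter_add_card_sdiff (X Y : Finset G) : (X ∩ Y).card + (X \ Y).card = X.card := by
  rw [add_comm]
  exact card_sdiff_add_card_inter X Y

theorem add_subgroup_union_coset {R B : Finset G} (hR : FinSub R) {b : G} (hb : b ∈ B) :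
    B ∪ coset R b + R = B + R := by
  apply Subset.antisymm
  · rw [union_add]
    refine union_subset Subset.rfl ?_
    rw [(hR.per_coset b).add_eq hR]
    exact coset_subset_add hb
  · exact add_subset_add_right subset_union_left

theorem union_coset_inter_coset {R B : Finset G} (hR : FinSub R) (b c : G) :
    (c ∈ coset R b → (B ∪ coset R b) ∩ coset R c = coset R c) ∧
      (c ∉ coset R b → (B ∪ coset R b) ∩ coset R c = B ∩ coset R c) := by
  constructor
  · intro h
    rw [hR.coset_eq h]
    exact inter_eq_right.2 subset_union_right
  · intro h
    ext x
    simp only [mem_inter, mem_union]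
    refine ⟨fun hx => ⟨hx.1.resolve_right fun hxb => ?_, hx.2⟩, fun hx => ⟨Or.inl hx.1, hx.2⟩⟩
    exact h (hR.coset_trans (hR.coset_comm hx.2) hxb)

theorem dfc_union_coset (A B R : Finset G) (b : G) :
    dfc A B + dfc A R ≤ dfc A (B ∩ coset R b) + dfc A (B ∪ coset R b) := by
  have := dfc_add_dfc_le A B (coset R b)
  rwa [dfc_coset] at this

/-- Completing cosets of `R` does not decrease the deficiency if no part of a coset beats `R`. -/
theorem dfc_le_add_subgroup {A R : Finset G} (hR : FinSub R) (n : ℕ) : ∀ B : Finset G,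
    (B + R).card - B.card = n → (∀ b ∈ B, dfc A (B ∩ coset R b) ≤ dfc A R) →
      dfc A B ≤ dfc A (B + R) := by
  induction n using Nat.strong_induction_on with
  | _ n ih =>
    intro B hn hB
    by_cases h : Per R B
    · rw [h.add_eq hR]
    · simp only [Per, not_forall] at h
      obtain ⟨r, hr, b, hb, hrb⟩ := h
      have hcos : r + b ∈ coset R b := by simpa [mem_coset] using hr
      have e := add_subgroup_union_coset hR hb
      have hlt : B.card < (B ∪ coset R b).card := card_lt_card (by
        rw [ssubset_iff_of_subset subset_union_left]
        exact ⟨r + b, mem_union_right _ hcos, hrb⟩)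
      have hle := card_le_card_add hR (B ∪ coset R b)
      rw [e] at hle
      have := ih ((B + R).card - (B ∪ coset R b).card) (by omega) (B ∪ coset R b) (by rw [e]) (by
        intro c hc
        by_cases hcb : c ∈ coset R b
        · rw [(union_coset_inter_coset hR b c).1 hcb, dfc_coset]
        · rw [(union_coset_inter_coset hR b c).2 hcb]
          exact hB c ((mem_union.1 hc).resolve_right hcb))
      rw [e] at this
      have h1 := dfc_union_coset A B R b
      have h2 := hB b hb
      omega

/-! ### Reductions -/

/-- `A` and `B` are `H`-periodic outside `a + H` and `b + H`, the coset `a + b + H` arises only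
from `a + H` and `b + H`, and the parts in these cosets form a critical pair. -/
structure Red (H A B : Finset G) (a b : G) : Prop where
  finSub : FinSub H
  mem_left : a ∈ A
  mem_right : b ∈ B
  per_left : Per H (A \ coset H a)
  per_right : Per H (B \ coset H b)
  uniq : ∀ {x y}, x ∈ A → y ∈ B → x + y ∈ coset H (a + b) → x ∈ coset H a ∧ y ∈ coset H b
  card : (A ∩ coset H a + B ∩ coset H b).card + 1 = (A ∩ coset H a).card + (B ∩ coset H b).card

theorem Red.symm {H A B : Finset G} {a b : G} (h : Red H A B a b) : Red H B A b a where
  finSub := h.finSub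
  mem_left := h.mem_right
  mem_right := h.mem_left
  per_left := h.per_right
  per_right := h.per_left
  uniq {x y} hx hy hxy := (h.uniq hy hx (by rwa [add_comm y x, add_comm a b])).symm
  card := by
    have := h.card
    rw [add_comm (B ∩ _)]
    omega

open Classical in
theorem exists_generated {R Y : Finset G} {b : G} (hR : FinSub R) (hY : Y ⊆ coset R b) :
    ∃ L, FinSub L ∧ L ⊆ R ∧ Y ⊆ coset L b ∧ ∀ S, FinSub S → Y ⊆ coset S b → L ⊆ S := by
  refine ⟨R.filter (· ∈ AddSubgroup.closure ((Y.image (· - b) : Finset G) : Set G)),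
    ⟨by simp [hR.zero, zero_mem], ?_, ?_⟩, filter_subset _ _, ?_, ?_⟩
  · intro x y hx hy
    rw [mem_filter] at *
    exact ⟨hR.add hx.1 hy.1, add_mem hx.2 hy.2⟩
  · intro x hx
    rw [mem_filter] at *
    exact ⟨hR.neg hx.1, neg_mem hx.2⟩
  · intro y hy
    rw [mem_coset, mem_filter]
    exact ⟨mem_coset.1 (hY hy), AddSubgroup.subset_closure (mem_coe.2 (mem_image_of_mem _ hy))⟩
  · intro S hS hYS x hx
    rw [mem_filter] at hx
    let K : AddSubgroup G :=
      { carrier := S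
        zero_mem' := hS.zero
        add_mem' := hS.add
        neg_mem' := hS.neg }
    have : AddSubgroup.closure ((Y.image (· - b) : Finset G) : Set G) ≤ K := by
      rw [AddSubgroup.closure_le]
      intro z hz
      simp only [coe_image, Set.mem_image, mem_coe] at hz
      obtain ⟨y, hy, rfl⟩ := hz
      exact mem_coset.1 (hYS hy)
    exact this hx.2

/-- The stabilizer S of X + Y does not contain L, so Y meets two cosets of S and |S| ≤ |Y + S| / 2
in Kneser's inequality. -/
theorem card_growth {L X Y : Finset G} {b : G} (hX : X.Nonempty) (hb : b ∈ Y)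
    (hL : ∀ S, FinSub S → Y ⊆ coset S b → L ⊆ S) (hp : ¬ Per L (X + Y)) :
    2 * X.card + Y.card ≤ 2 * (X + Y).card := by
  obtain ⟨S, hS, hpS, -, hle⟩ := kneser hX ⟨b, hb⟩
  have hn : ¬ Y ⊆ coset S b := fun h => hp (hpS.mono (hL S hS h))
  obtain ⟨y, hy, hyS⟩ := not_subset.1 hn
  have h1 := two_mul_card_le hS hb hy hyS
  have h2 := card_le_card_add hS X
  have h3 := card_le_card_add hS Y
  omega

-- A + B is the disjoint union of W and I + Y. By `hgood`, |W| ≥ |A \ I| + |B \ Y|, whence |I + Y| <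
-- |I| + |Y|. For the least subgroup L having Y in one coset, `card_growth` then permits only one
-- L-coset of I whose sum with Y is not L-periodic; that coset carries the reduction.
set_option maxHeartbeats 1000000 in
theorem exists_red_of_piece {R A B : Finset G} {b : G} (hR : FinSub R) (hap : Aper (A + B))
    (hd : 1 ≤ dfc A B) (hb : b ∈ B) (hper : Per R (A + (B \ coset R b)))
    (hgood : dfc A (B + R) ≤ dfc A R) (h2 : 2 ≤ (B ∩ coset R b).card) :
    ∃ L a, L ⊆ R ∧ L ≠ {0} ∧ Red L A B a b := by
  set W := A + (B \ coset R b) with hW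
  set Y := B ∩ coset R b with hY
  set I := A.filter (· + b ∉ W) with hI
  have hbY : b ∈ Y := mem_inter.2 ⟨hb, hR.self_mem_coset b⟩
  have hIA : I ⊆ A := filter_subset _ _
  have shift : ∀ {x y}, y ∈ coset R b → (x + y ∈ W ↔ x + b ∈ W) := by
    intro x y hy
    have hy := mem_coset.1 hy
    constructor
    · intro h
      have := hper _ (hR.neg hy) _ h
      rwa [show -(y - b) + (x + y) = x + b by abel] at this
    · intro h
      have := hper _ hy _ h
      rwa [show y - b + (x + b) = x + y by abel] at this
  have part : ∀ Z, Z ⊆ coset R b → A + (B \ coset R b ∪ Z) = W ∪ (I + Z) ∧ Disjoint W (I + Z) := by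
    intro Z hZ
    constructor
    · rw [add_union]
      apply Subset.antisymm
      · refine union_subset subset_union_left ?_
        intro x hx
        obtain ⟨a, ha, z, hz, rfl⟩ := mem_add.1 hx
        by_cases h : a + b ∈ W
        · exact mem_union_left _ ((shift (hZ hz)).2 h)
        · exact mem_union_right _ (add_mem_add (mem_filter.2 ⟨ha, h⟩) hz)
      · exact union_subset_union Subset.rfl (add_subset_add_right hIA)
    · rw [disjoint_right]
      intro x hx hxW
      obtain ⟨a, ha, z, hz, rfl⟩ := mem_add.1 hx
      exact (mem_filter.1 ha).2 ((shift (hZ hz)).1 hxW)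
  have hBY : B \ coset R b ∪ Y = B := sdiff_union_inter B _
  obtain ⟨e1, dj1⟩ := part Y inter_subset_right
  rw [hBY] at e1
  obtain ⟨e2, dj2⟩ := part (coset R b) Subset.rfl
  have e2' : A + (B + R) = W ∪ (I + coset R b) := by
    rw [← e2]
    have : B + R = (B \ coset R b + R) ∪ coset R b := by
      conv_lhs => rw [← hBY, union_add]
      congr 1
      apply Subset.antisymm
      · rw [← (hR.per_coset b).add_eq hR]
        exact add_subset_add_right inter_subset_right
      · exact coset_subset_add hbY
    rw [this, add_union, add_union, ← add_assoc, hper.add_eq hR]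
  have c1 := congrArg Finset.card e1
  rw [card_union_of_disjoint dj1] at c1
  have c2 := congrArg Finset.card e2'
  rw [card_union_of_disjoint dj2, add_coset, card_image_of_injective _ (add_right_injective b)] at c2
  have c3 := card_sdiff_coset_add hR hb
  have c4 : Y.card + (B \ coset R b).card = B.card := card_inter_add_card_sdiff B (coset R b)
  have c5 : (A + R).card = (I + R).card + ((A \ I) + R).card := by
    rw [← card_union_of_disjoint, ← union_add, union_sdiff_of_subset hIA]
    rw [disjoint_left]
    intro x hx hx'
    obtain ⟨a, ha, r, hr, rfl⟩ := mem_add.1 hx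
    obtain ⟨a', ha', r', hr', he⟩ := mem_add.1 hx'
    rw [mem_sdiff] at ha'
    refine (mem_filter.1 ha).2 ?_
    have h1 : a' + b ∈ W := by
      by_contra h
      exact ha'.2 (mem_filter.2 ⟨ha'.1, h⟩)
    have := hper _ (hR.sub hr' hr) _ h1
    rwa [show r' - r + (a' + b) = a + b by
      rw [show r' - r + (a' + b) = (a' + r') - r + b by abel, he]; abel] at this
  have c6 : A.card = I.card + (A \ I).card := by
    rw [← card_sdiff_add_card_eq_card hIA]
    ring
  have c7 := card_le_card_add hR (B \ coset R b)
  have c8 := card_le_card_add hR (A \ I)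
  obtain ⟨L, hL, hLR, hYL, hLmin⟩ := exists_generated (Y := Y) hR inter_subset_right
  have hL0 : L ≠ {0} := by
    rintro rfl
    have := card_le_card hYL
    rw [card_coset] at this
    simp at this
    omega
  have hnp : ¬ Per L (I + Y) := by
    intro h
    refine hL0 (hap.eq_bot hL ?_)
    rw [e1]
    exact (hper.mono hLR).union h
  have hnp' := hnp
  simp only [Per, not_forall] at hnp'
  obtain ⟨l, hl, z, hz, hlz⟩ := hnp'
  obtain ⟨a, ha, y₀, hy₀, rfl⟩ := mem_add.1 hz
  have hsatW : ∀ {x y : G}, y ∈ coset R x → x + b ∈ W → y + b ∈ W := by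
    intro x y hy h
    have := hper _ (mem_coset.1 hy) _ h
    rwa [show y - x + (x + b) = y + b by abel] at this
  have cosLR : ∀ x, coset L x ⊆ coset R x := fun x z hz => mem_coset.2 (hLR (mem_coset.1 hz))
  have hAe : A ∩ coset L a = I ∩ coset L a := by
    ext x
    simp only [mem_inter]
    refine ⟨fun h => ⟨mem_filter.2 ⟨h.1, fun hx => (mem_filter.1 ha).2 ?_⟩, h.2⟩,
      fun h => ⟨hIA h.1, h.2⟩⟩
    exact hsatW (hR.coset_comm (cosLR _ h.2)) hx
  have hsum : I + Y = (I ∩ coset L a + Y) ∪ (I \ coset L a + Y) := by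
    rw [← union_add, union_comm, sdiff_union_inter]
  have hdj : Disjoint (I ∩ coset L a + Y) (I \ coset L a + Y) := by
    rw [disjoint_left]
    intro x hx hx'
    obtain ⟨a₁, ha₁, y₁, hy₁, rfl⟩ := mem_add.1 hx
    obtain ⟨a₂, ha₂, y₂, hy₂, he⟩ := mem_add.1 hx'
    refine (mem_sdiff.1 ha₂).2 ?_
    have i1 := mem_coset.1 (mem_inter.1 ha₁).2
    have i2 := mem_coset.1 (hYL hy₁)
    have i3 := mem_coset.1 (hYL hy₂)
    rw [mem_coset]
    have : a₂ - a = (a₁ - a) + ((y₁ - b) - (y₂ - b)) := by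
      have : a₂ = a₁ + y₁ - y₂ := by rw [← he]; abel
      rw [this]; abel
    rw [this]
    exact hL.add i1 (hL.sub i2 i3)
  have c9 := congrArg Finset.card hsum
  rw [card_union_of_disjoint hdj] at c9
  have c10 := card_inter_add_card_sdiff I (coset L a)
  have haI : a ∈ I ∩ coset L a := mem_inter.2 ⟨ha, hL.self_mem_coset a⟩
  have hnpe : ¬ Per L (I ∩ coset L a + Y) := fun h =>
    hlz (hsum ▸ mem_union_left _ (h l hl _ (add_mem_add haI hy₀)))
  have g1 := card_growth ⟨a, haI⟩ hbY hLmin hnpe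
  -- A second non-periodic part would gain |Y| / 2 again, giving |I + Y| ≥ |I| + |Y|.
  have hpr : Per L (I \ coset L a + Y) := by
    by_contra h
    have hne : (I \ coset L a).Nonempty := by
      by_contra hne
      rw [not_nonempty_iff_eq_empty] at hne
      exact h (by rw [hne, empty_add]; intro _ _ _ hx; simp at hx)
    have g2 := card_growth hne hbY hLmin h
    simp only [dfc] at hd hgood
    omega
  -- A period of this part lies in `L`, and the rest of `A + B` is `L`-periodic.
  have hape : Aper (I ∩ coset L a + Y) := by
    intro g hg
    have h1 := hg _ (add_mem_add haI hbY)
    obtain ⟨a₁, ha₁, y₁, hy₁, he⟩ := mem_add.1 h1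
    have hgL : g ∈ L := by
      have i1 := mem_coset.1 (mem_inter.1 ha₁).2
      have i2 := mem_coset.1 (hYL hy₁)
      have : g = (a₁ - a) + (y₁ - b) := by
        rw [show a₁ - a + (y₁ - b) = a₁ + y₁ - a - b by abel, he]; abel
      rw [this]
      exact hL.add i1 i2
    apply hap
    intro x hx
    rw [e1, hsum] at hx ⊢
    simp only [mem_union] at hx ⊢
    rcases hx with h | h | h
    · exact Or.inl (hper g (hLR hgL) x h)
    · exact Or.inr (Or.inl (hg x h))
    · exact Or.inr (Or.inr (hpr g hgL x h))
  have c11 := dfc_le_one ⟨a, haI⟩ ⟨b, hbY⟩ hape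
  have hsubr : (I \ coset L a).image (· + b) ⊆ I \ coset L a + Y := by
    intro x hx
    obtain ⟨a₁, ha₁, rfl⟩ := mem_image.1 hx
    exact add_mem_add ha₁ hbY
  have c12 := card_le_card hsubr
  rw [card_image_of_injective _ (add_left_injective b)] at c12
  simp only [dfc] at hd hgood c11
  -- The bound `c11` leaves no slack in the earlier estimates, so the remaining pieces are
  -- saturated.
  have hBper : Per R (B \ coset R b) := per_of_card_le hR (by omega)
  have hAper : Per R (A \ I) := per_of_card_le hR (by omega)
  have hreq : (I \ coset L a).image (· + b) = I \ coset L a + Y :=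
    eq_of_subset_of_card_le hsubr (by
      rw [card_image_of_injective _ (add_left_injective b)]; omega)
  have hIper : Per L (I \ coset L a) := by
    intro t ht x hx
    have := hpr t ht (x + b) (hreq ▸ mem_image_of_mem _ hx)
    rw [← hreq, mem_image] at this
    obtain ⟨w, hw, he⟩ := this
    have : w = t + x := by
      rw [← add_assoc] at he
      exact add_right_cancel he
    rwa [← this]
  have hBL : B ∩ coset L b = Y := by
    ext x
    simp only [mem_inter, hY]
    exact ⟨fun h => ⟨h.1, cosLR _ h.2⟩, fun h => ⟨h.1, hYL (mem_inter.2 h)⟩⟩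
  refine ⟨L, a, hLR, hL0, hL, hIA ha, hb, ?_, ?_, ?_, ?_⟩
  · have : A \ coset L a = (A \ I) ∪ (I \ coset L a) := by
      ext x
      rw [mem_sdiff, mem_union, mem_sdiff, mem_sdiff]
      constructor
      · intro h
        by_cases hx : x ∈ I
        · exact Or.inr ⟨hx, h.2⟩
        · exact Or.inl ⟨h.1, hx⟩
      · rintro (h | h)
        · exact ⟨h.1, fun hx => h.2 (mem_inter.1 (hAe ▸ mem_inter.2 ⟨h.1, hx⟩)).1⟩
        · exact ⟨hIA h.1, h.2⟩
    rw [this]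
    exact (hAper.mono hLR).union hIper
  · have : B \ coset L b = B \ coset R b := by
      ext x
      rw [mem_sdiff, mem_sdiff]
      refine ⟨fun h => ⟨h.1, fun hx => h.2 (hYL (mem_inter.2 ⟨h.1, hx⟩))⟩,
        fun h => ⟨h.1, fun hx => h.2 (cosLR _ hx)⟩⟩
    rw [this]
    exact hBper.mono hLR
  · intro x y hx hy hxy
    have hyR : y ∈ coset R b := by
      by_contra h
      have h1 : x + y ∈ W := add_mem_add hx (mem_sdiff.2 ⟨hy, h⟩)
      have h2 := hper _ (hR.neg (hLR (mem_coset.1 hxy))) _ h1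
      rw [show -(x + y - (a + b)) + (x + y) = a + b by abel] at h2
      exact (mem_filter.1 ha).2 h2
    have hyL := hYL (mem_inter.2 ⟨hy, hyR⟩)
    refine ⟨?_, hyL⟩
    rw [mem_coset] at hxy hyL ⊢
    have := hL.sub hxy hyL
    rwa [show x + y - (a + b) - (y - b) = x - a by abel] at this
  · rw [hAe, hBL]
    omega

/-- If removing `b` from `B` makes the sumset periodic, this period is a reduction. -/
theorem red_of_erase {A B : Finset G} {a b : G} (hd : dfc A B = 1) (ha : a ∈ A) (hb : b ∈ B)
    (hne : (B.erase b).Nonempty) (hab : a + b ∉ A + B.erase b)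
    (hp : ¬ Aper (A + B.erase b)) :
    ∃ H, Red H A B a b ∧ H ≠ {0} ∧ (∃ z, z ∉ H) ∧
      ∀ P, Per P (A + B.erase b) → P ⊆ H := by
  obtain ⟨S, hS, hpS, hg, hle⟩ := kneser ⟨a, ha⟩ hne
  have hS0 : S ≠ {0} := by
    rintro rfl
    refine hp fun g hg' => ?_
    simpa using hg g hg'
  have hbS : ∀ y ∈ B.erase b, y ∉ coset S b := by
    intro y hy hyb
    refine hab ?_
    have := hpS _ (mem_coset.1 (hS.coset_comm hyb)) _ (add_mem_add ha hy)
    rwa [show b - y + (a + y) = a + b by abel] at this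
  have hB0 : B ∩ coset S b = {b} := by
    ext y
    simp only [mem_inter, mem_singleton]
    refine ⟨fun h => ?_, ?_⟩
    · by_contra hyb
      exact hbS y (mem_erase.2 ⟨hyb, h.1⟩) h.2
    · rintro rfl
      exact ⟨hb, hS.self_mem_coset _⟩
  have hB1 : B \ coset S b = B.erase b := by
    ext y
    simp only [mem_sdiff, mem_erase]
    refine ⟨fun h => ⟨?_, h.1⟩, fun h => ⟨h.2, hbS y (mem_erase.2 h)⟩⟩
    rintro rfl
    exact h.2 (hS.self_mem_coset _)
  -- Restoring `b` adds at least |A ∩ (a + S)| sums, which forces equality in Kneser's inequality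
  -- for `A` and `B.erase b`.
  have hdj : Disjoint (A + B.erase b) ((A ∩ coset S a).image (· + b)) := by
    rw [disjoint_right]
    intro z hz hz'
    obtain ⟨x, hx, rfl⟩ := mem_image.1 hz
    refine hab ?_
    have := hpS _ (hS.neg (mem_coset.1 (mem_inter.1 hx).2)) _ hz'
    rwa [show -(x - a) + (x + b) = a + b by abel] at this
  have hsub : (A + B.erase b) ∪ (A ∩ coset S a).image (· + b) ⊆ A + B := by
    refine union_subset (add_subset_add_left (erase_subset _ _)) ?_
    intro z hz
    obtain ⟨x, hx, rfl⟩ := mem_image.1 hz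
    exact add_mem_add (mem_inter.1 hx).1 hb
  have c1 := card_le_card hsub
  rw [card_union_of_disjoint hdj, card_image_of_injective _ (add_left_injective b)] at c1
  have c2 := card_sdiff_coset_add hS ha
  have c3 := card_inter_add_card_sdiff A (coset S a)
  have c4 := card_le_card_add hS (A \ coset S a)
  have c5 := card_le_card_add hS (B.erase b)
  have c6 := card_erase_add_one hb
  simp only [dfc] at hd
  refine ⟨S, ⟨hS, ha, hb, per_of_card_le hS (by omega), ?_, ?_, ?_⟩, hS0, ?_, ?_⟩
  · rw [hB1]
    exact per_of_card_le hS (by omega)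
  · intro x y hx hy hxy
    have hyb : y = b := by
      by_contra h
      refine hab ?_
      have := hpS _ (hS.neg (mem_coset.1 hxy)) _ (add_mem_add hx (mem_erase.2 ⟨h, hy⟩))
      rwa [show -(x + y - (a + b)) + (x + y) = a + b by abel] at this
    subst hyb
    refine ⟨?_, hS.self_mem_coset _⟩
    rw [mem_coset] at *
    simpa using hxy
  · rw [hB0, add_singleton, card_vadd_finset]
    simp
  · obtain ⟨y, hy⟩ := hne
    exact ⟨y - b, fun h => hbS y hy (mem_coset.2 h)⟩
  · intro P hP t ht
    exact hg t (hP t ht)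

theorem card_dvd_of_per {T : Finset G} (hT : FinSub T) (n : ℕ) : ∀ X : Finset G, X.card = n →
    Per T X → T.card ∣ X.card := by
  induction n using Nat.strong_induction_on with
  | _ n ih =>
    intro X hn hX
    rcases X.eq_empty_or_nonempty with rfl | ⟨x, hx⟩
    · simp
    · have h1 := card_sdiff_coset_add hT hx
      rw [hX.add_eq hT, (hX.sdiff hT (hT.per_coset x)).add_eq hT] at h1
      have h2 := hT.card_pos
      have := ih _ (by omega) _ rfl (hX.sdiff hT (hT.per_coset x))
      rw [h1]
      exact dvd_add this dvd_rfl

theorem add_add_of_subset {S R : Finset G} (hS : FinSub S) (hR : FinSub R) (h : S ⊆ R)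
    (X : Finset G) : X + S + R = X + R := by
  rw [add_assoc]
  congr 1
  rw [add_comm]
  exact (hR.per_self.mono h).add_eq hS

/-- A + H consists of A \ (a + H) and one full coset. In particular the subgroup of a reduction
always has positive deficiency. -/
theorem dfc_of_per_sdiff {A H : Finset G} {a : G} (hH : FinSub H) (ha : a ∈ A)
    (hp : Per H (A \ coset H a)) : dfc A H = (A ∩ coset H a).card := by
  have h1 := card_sdiff_coset_add hH ha
  rw [hp.add_eq hH] at h1
  have h2 := card_inter_add_card_sdiff A (coset H a)
  simp only [dfc]
  omega

/-! ### Critical pairs without reductions: subgroups R with A + B + R ≠ G -/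

/-- A critical pair with aperiodic sumset that has no reduction. -/
structure Crit (A B : Finset G) : Prop where
  aper : Aper (A + B)
  dfc_eq : dfc A B = 1
  two_le_left : 2 ≤ A.card
  two_le_right : 2 ≤ B.card
  no_red : ∀ H a b, Red H A B a b → H ≠ {0} → ∀ z, z ∈ H

namespace Crit

variable {A B : Finset G}

theorem symm (h : Crit A B) : Crit B A where
  aper := by rw [add_comm]; exact h.aper
  dfc_eq := by rw [dfc_comm]; exact h.dfc_eq
  two_le_left := h.two_le_right
  two_le_right := h.two_le_left
  no_red H a b hr := h.no_red H b a hr.symm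

theorem left_nonempty (h : Crit A B) : A.Nonempty :=
  card_pos.1 (by have := h.two_le_left; omega)

theorem right_nonempty (h : Crit A B) : B.Nonempty := h.symm.left_nonempty

theorem erase_nonempty (h : Crit A B) (b : G) : (B.erase b).Nonempty := by
  have h1 := h.two_le_right
  have h2 := pred_card_le_card_erase (s := B) (a := b)
  exact card_pos.1 (by omega)

/-- Either dropping `b` changes no sum, or some `a + b` is lost and a period would yield a proper
reduction by `red_of_erase`. -/
theorem aper_erase (h : Crit A B) {b : G} (hb : b ∈ B) : Aper (A + B.erase b) := by
  by_contra hp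
  have hex : ∃ a ∈ A, a + b ∉ A + B.erase b := by
    by_contra! hc
    refine hp ?_
    have : A + B.erase b = A + B := by
      refine Subset.antisymm (add_subset_add_left (erase_subset _ _)) fun x hx => ?_
      obtain ⟨a, ha, y, hy, rfl⟩ := mem_add.1 hx
      by_cases hyb : y = b
      · rw [hyb]
        exact hc a ha
      · exact add_mem_add ha (mem_erase.2 ⟨hyb, hy⟩)
    rw [this]
    exact h.aper
  obtain ⟨a, ha, hab⟩ := hex
  obtain ⟨H, hr, h0, ⟨z, hz⟩, -⟩ := red_of_erase h.dfc_eq ha hb (h.erase_nonempty b) hab hp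
  exact hz (h.no_red H a b hr h0 z)

theorem not_per_erase (h : Crit A B) {R : Finset G} (hR : FinSub R) (h0 : R ≠ {0}) {x : G}
    (hx : x ∈ A) : ¬ Per R (A.erase x) := by
  intro hp
  have := h.symm.aper_erase hx
  rw [add_comm] at this
  exact h0 (this.eq_bot hR (hp.add_left B))

/-- With nothing outside the coset, `exists_red_of_piece` would produce a reduction inside `R`. -/
theorem not_subset_coset (h : Crit A B) {R : Finset G} (hR : FinSub R) {z : G} (hz : z ∉ R)
    (c : G) : ¬ B ⊆ coset R c := by
  intro hB
  obtain ⟨b, hb⟩ := h.right_nonempty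
  rw [← hR.coset_eq (hB hb)] at hB
  have e : B \ coset R b = ∅ := sdiff_eq_empty_iff_subset.2 hB
  have e2 : B + R = coset R b := by
    apply Subset.antisymm
    · rw [← (hR.per_coset b).add_eq hR]
      exact add_subset_add_right hB
    · exact coset_subset_add hb
  obtain ⟨L, a, hL, hL0, hr⟩ := exists_red_of_piece hR h.aper h.dfc_eq.ge hb
    (by rw [e, add_empty]; intro _ _ _ hx; simp at hx) (by rw [e2, dfc_coset])
    (by rw [inter_eq_left.2 hB]; exact h.two_le_right)
  exact hz (hL (h.no_red L a b hr hL0 z))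

/-- If a proper subgroup has more than half the deficiency of R, a best such subgroup again
dominates, and the induction descends to it. Otherwise each part of B whose sum with A is not
R-periodic has at most half. Two such parts force `dfc A B ≤ 0`; a single one contradicts
irreducibility, through `exists_red_of_piece` or `aper_erase`. -/
theorem false_of_dominating (h : Crit A B) (n : ℕ) : ∀ R : Finset G, R.card = n → FinSub R →
    2 ≤ dfc A R → dfc A (B + R) ≤ dfc A R → (∀ S ⊆ R, FinSub S → dfc A S ≤ dfc A R) →
    (∃ z, z ∉ R) → False := by
  classical
  induction n using Nat.strong_induction_on with
  | _ n ih =>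
    intro R hn hR h2 hgood hmax ⟨z, hz⟩
    have hpiece : ∀ Y : Finset G, Y.Nonempty → ∀ b, Y ⊆ coset R b → dfc A Y ≤ dfc A R := by
      intro Y hY b hYb
      rcases dfc_piece_cases h.left_nonempty hY hR hYb with h1 | h1 | h1 | ⟨S, hSR, hS, -, hle, -⟩
      · have := dfc_le_one h.left_nonempty hY h1
        omega
      · omega
      · obtain ⟨y, rfl⟩ := card_eq_one.1 h1
        rw [dfc_singleton]
        omega
      · exact hle.trans (hmax S hSR hS)
    have hmono : ∀ B' : Finset G, dfc A B' ≤ dfc A (B' + R) := fun B' =>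
      dfc_le_add_subgroup hR _ B' rfl fun b hb =>
        hpiece _ ⟨b, mem_inter.2 ⟨hb, hR.self_mem_coset b⟩⟩ b inter_subset_right
    by_cases hex : ∃ S ∈ R.powerset.filter (fun S => FinSub S ∧ S ≠ R), dfc A R < 2 * dfc A S
    · obtain ⟨S₀, hS₀, hd₀⟩ := hex
      obtain ⟨S, hS, hSmax⟩ := exists_max_image _ (dfc A) ⟨S₀, hS₀⟩
      have hd := hSmax S₀ hS₀
      simp only [mem_filter, mem_powerset] at hS hSmax
      obtain ⟨hSR, hSf, hSne⟩ := hS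
      refine ih S.card ?_ S rfl hSf (by omega) ?_ ?_ ⟨z, fun hc => hz (hSR hc)⟩
      · rw [← hn]
        exact card_lt_card (hSR.ssubset_of_ne hSne)
      · by_contra hc
        have h3 : dfc A (B + S) ≤ dfc A R := by
          refine (hmono _).trans ?_
          rwa [add_add_of_subset hSf hR hSR]
        have h4 : dfc A S ≤ S.card := dfc_le_card' ⟨0, hSf.zero⟩
        -- The two deficiencies differ by a multiple of |S| ≥ `dfc A S`, so a failure gives `dfc A
        -- (B + S)` ≥ 2 `dfc A S` > `dfc A R`.
        have d1 := card_dvd_of_per hSf _ (B + S) rfl (per_add hSf B)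
        have d2 := card_dvd_of_per hSf _ (A + (B + S)) rfl ((per_add hSf B).add_right A)
        have d3 := card_dvd_of_per hSf _ (A + S) rfl (per_add hSf A)
        have d4 : (S.card : ℤ) ∣ dfc A (B + S) - dfc A S := by
          have : dfc A (B + S) - dfc A S =
              ((B + S).card : ℤ) - ((A + (B + S)).card : ℤ) - S.card + (A + S).card := by
            simp only [dfc]
            ring
          rw [this]
          exact dvd_add (dvd_sub (dvd_sub (by exact_mod_cast d1) (by exact_mod_cast d2)) dvd_rfl)
            (by exact_mod_cast d3)
        have := Int.le_of_dvd (by omega) d4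
        omega
      · intro S' hS' hS'f
        by_cases hR' : S' = R
        · exact absurd (Subset.antisymm hSR (hR' ▸ hS')) hSne
        · exact hSmax S' ⟨hS'.trans hSR, hS'f, hR'⟩
    · push Not at hex
      simp only [mem_filter, mem_powerset] at hex
      have hhalf : ∀ b ∈ B, ¬ Per R (A + B ∩ coset R b) →
          2 * dfc A (B ∩ coset R b) ≤ dfc A R := by
        intro b hb hnp
        have hY : (B ∩ coset R b).Nonempty := ⟨b, mem_inter.2 ⟨hb, hR.self_mem_coset b⟩⟩
        rcases dfc_piece_cases h.left_nonempty hY hR inter_subset_right with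
          h1 | h1 | h1 | ⟨S, hSR, hS, -, hle, hfull⟩
        · have := dfc_le_one h.left_nonempty hY h1
          omega
        · omega
        · obtain ⟨y, hy⟩ := card_eq_one.1 h1
          rw [hy, dfc_singleton]
          omega
        · have := hex S ⟨hSR, hS, fun hE => hnp (hfull hE.ge)⟩
          omega
      have hex2 : ∃ b ∈ B, ¬ Per R (A + B ∩ coset R b) := by
        by_contra! hc
        have : Per R (A + B) := by
          intro t ht x hx
          obtain ⟨a, ha, b, hb, rfl⟩ := mem_add.1 hx
          exact add_subset_add_left inter_subset_left
            (hc b hb t ht _ (add_mem_add ha (mem_inter.2 ⟨hb, hR.self_mem_coset b⟩)))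
        have := h.aper.eq_bot hR this
        rw [this, dfc_singleton] at h2
        omega
      obtain ⟨b₀, hb₀, hnp₀⟩ := hex2
      have hothers : ∀ b ∈ B, b ∉ coset R b₀ → Per R (A + B ∩ coset R b) := by
        intro b hb hbb
        by_contra hnp
        have e1 := dfc_union_coset A B R b₀
        have e2 := dfc_union_coset A (B ∪ coset R b₀) R b
        rw [(union_coset_inter_coset hR b₀ b).2 hbb] at e2
        have e3 := hmono (B ∪ coset R b₀ ∪ coset R b)
        rw [add_subgroup_union_coset hR (mem_union_left _ hb), add_subgroup_union_coset hR hb₀] at e3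
        have e4 := hhalf b₀ hb₀ hnp₀
        have e5 := hhalf b hb hnp
        have e6 := h.dfc_eq
        omega
      have hper : Per R (A + (B \ coset R b₀)) := by
        intro t ht x hx
        obtain ⟨a, ha, b, hb, rfl⟩ := mem_add.1 hx
        rw [mem_sdiff] at hb
        refine add_subset_add_left ?_ (hothers b hb.1 hb.2 t ht _
          (add_mem_add ha (mem_inter.2 ⟨hb.1, hR.self_mem_coset b⟩)))
        intro y hy
        rw [mem_inter] at hy
        exact mem_sdiff.2 ⟨hy.1, fun hyb => hb.2 (hR.coset_trans (hR.coset_comm hy.2) hyb)⟩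
      have hmem : b₀ ∈ B ∩ coset R b₀ := mem_inter.2 ⟨hb₀, hR.self_mem_coset b₀⟩
      by_cases hcard : 2 ≤ (B ∩ coset R b₀).card
      · obtain ⟨L, a, hL, hL0, hr⟩ := exists_red_of_piece hR h.aper h.dfc_eq.ge hb₀ hper hgood hcard
        exact hz (hL (h.no_red L a b₀ hr hL0 z))
      · have h1 : (B ∩ coset R b₀).card = 1 := by
          have := card_pos.2 ⟨b₀, hmem⟩
          omega
        have e : B \ coset R b₀ = B.erase b₀ := by
          obtain ⟨y, hy⟩ := card_eq_one.1 h1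
          rw [hy, mem_singleton] at hmem
          subst hmem
          rw [← sdiff_inter_self_left, hy, sdiff_singleton_eq_erase]
        rw [e] at hper
        have := (h.aper_erase hb₀).eq_bot hR hper
        rw [this, dfc_singleton] at h2
        omega

/-- A subgroup Q of largest deficiency among those with A + B + Q ≠ G is dominating: the stabilizer
of A + B + Q belongs to the same family. -/
theorem dfc_subgroup_le_one (h : Crit A B) {T : Finset G} (hT : FinSub T) {z : G}
    (hz : z ∉ A + (B + T)) : dfc A T ≤ 1 := by
  by_contra hc
  obtain ⟨m, ⟨Q, hQ, ⟨w, hw⟩, rfl⟩, hmax⟩ := Int.exists_greatest_of_bdd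
    (P := fun m => ∃ Q, FinSub Q ∧ (∃ z, z ∉ A + (B + Q)) ∧ dfc A Q = m)
    ⟨A.card, by rintro _ ⟨Q, -, -, rfl⟩; exact dfc_le_card h.left_nonempty⟩
    ⟨_, T, hT, ⟨z, hz⟩, rfl⟩
  have hTQ := hmax _ ⟨T, hT, ⟨z, hz⟩, rfl⟩
  have hne : (B + Q).Nonempty := h.right_nonempty.add ⟨0, hQ.zero⟩
  refine h.false_of_dominating _ Q rfl hQ (by omega) ?_ ?_ ?_
  · obtain ⟨S, hS, hpS, -, hle⟩ := exists_dfc_le h.left_nonempty hne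
    refine (dfc_le_stab hS hle).trans (hmax _ ⟨S, hS, ⟨w, fun hc => hw ?_⟩, rfl⟩)
    rw [← hpS.add_eq hS, add_assoc]
    refine add_subset_add_left (add_subset_add_right ?_) hc
    exact subset_add hQ
  · intro S hS hSf
    exact hmax _ ⟨S, hSf, ⟨w, fun hc =>
      hw (add_subset_add_left (add_subset_add_left hS) hc)⟩, rfl⟩
  · by_contra! hc
    obtain ⟨a, ha⟩ := h.left_nonempty
    obtain ⟨b, hb⟩ := h.right_nonempty
    refine hw (mem_add.2 ⟨a, ha, w - a, mem_add.2 ⟨b, hb, w - a - b, hc _, ?_⟩, ?_⟩) <;> abel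

end Crit

/-- The sum A + Y must be aperiodic, so `exists_red_of_piece` applies to (A, Y). Its subgroup has
positive deficiency |A ∩ (a + L)|, hence equals R by minimality, and |A ∩ (a + R)| = 1. -/
theorem exists_per_erase {A R Y : Finset G} {b : G} (hA : A.Nonempty) (hR : FinSub R)
    (h1 : dfc A R ≤ 1) (hmin : ∀ S ⊆ R, FinSub S → S ≠ {0} → S ≠ R → dfc A S ≤ 0)
    (hYb : Y ⊆ coset R b) (h2 : 2 ≤ Y.card) (hnp : ¬ Per R (A + Y)) (hd : 1 ≤ dfc A Y) :
    ∃ x ∈ A, Per R (A.erase x) := by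
  obtain ⟨y, hy⟩ : Y.Nonempty := card_pos.1 (by omega)
  rcases dfc_piece_cases hA ⟨y, hy⟩ hR hYb with h | h | h | ⟨S, hSR, hS, hS0, hle, hfull⟩
  · rw [← hR.coset_eq (hYb hy)] at hYb
    have e : Y \ coset R y = ∅ := sdiff_eq_empty_iff_subset.2 hYb
    have e2 : Y + R = coset R y := by
      apply Subset.antisymm
      · rw [← (hR.per_coset y).add_eq hR]
        exact add_subset_add_right hYb
      · exact coset_subset_add hy
    obtain ⟨L, a, hL, hL0, hr⟩ := exists_red_of_piece hR h hd hy
      (by rw [e, add_empty]; intro _ _ _ hx; simp at hx) (by rw [e2, dfc_coset])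
      (by rwa [inter_eq_left.2 hYb])
    have h3 := dfc_of_per_sdiff hr.finSub hr.mem_left hr.per_left
    have hmem : a ∈ A ∩ coset L a := mem_inter.2 ⟨hr.mem_left, hr.finSub.self_mem_coset a⟩
    have h4 := card_pos.2 ⟨a, hmem⟩
    have hLR : L = R := by
      by_contra hne
      have := hmin L hL hr.finSub hL0 hne
      omega
    subst hLR
    refine ⟨a, hr.mem_left, ?_⟩
    obtain ⟨w, hw⟩ := card_eq_one.1 (show (A ∩ coset L a).card = 1 by omega)
    rw [hw, mem_singleton] at hmem
    subst hmem
    rw [← sdiff_singleton_eq_erase, ← hw, sdiff_inter_self_left]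
    exact hr.per_left
  · omega
  · omega
  · have := hmin S hSR hS hS0 (fun hE => hnp (hfull hE.ge))
    omega

/-- A smallest counterexample R has deficiency 1. Some part of B has positive deficiency and a
non-R-periodic sum with A, and `exists_per_erase` leaves only a singleton {b}. This isolates a point
of A in its R-coset, and the rest of A is R-periodic, against `not_per_erase`. -/
theorem Crit.dfc_subgroup_nonpos {A B : Finset G} (h : Crit A B) (n : ℕ) : ∀ R : Finset G,
    R.card = n → FinSub R → R ≠ {0} → (∃ z, z ∉ A + (B + R)) → dfc A R ≤ 0 := by
  induction n using Nat.strong_induction_on with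
  | _ n ih =>
    intro R hn hR hR0 ⟨z, hz⟩
    by_contra hpos
    have hd1 : dfc A R = 1 := by
      have := h.dfc_subgroup_le_one hR hz
      omega
    have hmin : ∀ S ⊆ R, FinSub S → S ≠ {0} → S ≠ R → dfc A S ≤ 0 := by
      intro S hSR hS hS0 hne
      refine ih S.card ?_ S rfl hS hS0
        ⟨z, fun hc => hz (add_subset_add_left (add_subset_add_left hSR) hc)⟩
      rw [← hn]
      exact card_lt_card (hSR.ssubset_of_ne hne)
    have hpiece : ∀ Y : Finset G, Y.Nonempty → ∀ b, Y ⊆ coset R b → dfc A Y ≤ dfc A R := by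
      intro Y hY b hYb
      rw [hd1]
      rcases dfc_piece_cases h.left_nonempty hY hR hYb with h1 | h1 | h1 | ⟨S, hSR, hS, hS0, hle, -⟩
      · exact dfc_le_one h.left_nonempty hY h1
      · omega
      · obtain ⟨y, rfl⟩ := card_eq_one.1 h1
        rw [dfc_singleton]
      · by_cases hE : S = R
        · rw [hE] at hle
          omega
        · have := hmin S hSR hS hS0 hE
          omega
    have hmono : ∀ B' : Finset G, dfc A B' ≤ dfc A (B' + R) := fun B' =>
      dfc_le_add_subgroup hR _ B' rfl fun b hb =>
        hpiece _ ⟨b, mem_inter.2 ⟨hb, hR.self_mem_coset b⟩⟩ b inter_subset_right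
    have hgood : dfc A (B + R) ≤ 1 := by
      obtain ⟨S, hS, hpS, -, hle⟩ := exists_dfc_le h.left_nonempty
        (h.right_nonempty.add ⟨0, hR.zero⟩)
      refine (dfc_le_stab hS hle).trans (h.dfc_subgroup_le_one hS (z := z) fun hc => hz ?_)
      rw [← hpS.add_eq hS, add_assoc]
      exact add_subset_add_left (add_subset_add_right (subset_add hR)) hc
    have hex : ∃ b ∈ B, ¬ Per R (A + B ∩ coset R b) := by
      by_contra! hc
      refine hR0 (h.aper.eq_bot hR fun t ht x hx => ?_)
      obtain ⟨a, ha, b, hb, rfl⟩ := mem_add.1 hx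
      exact add_subset_add_left inter_subset_left
        (hc b hb t ht _ (add_mem_add ha (mem_inter.2 ⟨hb, hR.self_mem_coset b⟩)))
    obtain ⟨b, hb, hnp⟩ := hex
    have hbb : b ∈ B ∩ coset R b := mem_inter.2 ⟨hb, hR.self_mem_coset b⟩
    have u1 := dfc_union_coset A B R b
    have u2 := hmono (B ∪ coset R b)
    rw [add_subgroup_union_coset hR hb] at u2
    have u3 := h.dfc_eq
    have hsingle : B ∩ coset R b = {b} := by
      by_contra hne
      have h2 : 2 ≤ (B ∩ coset R b).card := by
        have := card_pos.2 ⟨b, hbb⟩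
        by_contra hlt
        obtain ⟨y, hy⟩ := card_eq_one.1 (show (B ∩ coset R b).card = 1 by omega)
        rw [hy, mem_singleton] at hbb
        exact hne (hbb ▸ hy)
      obtain ⟨x, hx, hp⟩ := exists_per_erase h.left_nonempty hR hd1.le hmin inter_subset_right h2 hnp
        (by omega)
      exact h.not_per_erase hR hR0 hx hp
    have hAne : ∃ a ∈ A, ∃ r ∈ R, a + r ∉ A := by
      by_contra! hc
      have : A + R ⊆ A := by
        intro x hx
        obtain ⟨a, ha, r, hr, rfl⟩ := mem_add.1 hx
        exact hc a ha r hr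
      have := card_le_card this
      have := hR.two_le_card hR0
      simp only [dfc] at hd1
      omega
    obtain ⟨a, ha, r, hr, har⟩ := hAne
    -- If x + b = a' + b', filling the coset of b' makes supermodularity at the coset of b an
    -- equality. Then `inter_subset_of_dfc_le` puts the hole a + r into A.
    have huniq : ∀ x ∈ A ∩ coset R a, x + b ∉ A + B.erase b := by
      intro x hx hc
      rw [mem_inter] at hx
      obtain ⟨a', ha', b', hb', he⟩ := mem_add.1 hc
      rw [mem_erase] at hb'
      have hb'c : b ∉ coset R b' := by
        intro hcc
        have : b' ∈ B ∩ coset R b := mem_inter.2 ⟨hb'.2, hR.coset_comm hcc⟩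
        rw [hsingle, mem_singleton] at this
        exact hb'.1 this
      have v1 := dfc_union_coset A B R b'
      have v2 := hmono (B ∪ coset R b' ∪ coset R b)
      rw [add_subgroup_union_coset hR (mem_union_left _ hb),
        add_subgroup_union_coset hR hb'.2] at v2
      have v3 := hpiece _ ⟨b', mem_inter.2 ⟨hb'.2, hR.self_mem_coset b'⟩⟩ b' inter_subset_right
      have v4 : (B ∪ coset R b') ∩ coset R b = {b} := by
        rw [(union_coset_inter_coset hR b' b).2 hb'c, hsingle]
      have v5 := inter_subset_of_dfc_le (A := A) (X := B ∪ coset R b') (Y := coset R b) (by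
        rw [v4, dfc_coset, dfc_singleton]
        omega)
      rw [v4] at v5
      have m1 : a + r + b ∈ A + (B ∪ coset R b') := by
        refine mem_add.2 ⟨a', ha', a + r + b - a', mem_union_right _ (mem_coset.2 ?_), by abel⟩
        have hxa := mem_coset.1 hx.2
        have : a + r + b - a' - b' = r - (x - a) := by
          rw [show a + r + b - a' - b' = a + r + b - (a' + b') by abel, he]
          abel
        rw [this]
        exact hR.sub hr hxa
      have m2 : a + r + b ∈ A + coset R b :=
        mem_add.2 ⟨a, ha, r + b, mem_coset.2 (by simpa using hr), by abel⟩
      obtain ⟨w, hw, v, hv, he2⟩ := mem_add.1 (v5 (mem_inter.2 ⟨m1, m2⟩))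
      rw [mem_singleton] at hv
      subst hv
      rw [add_left_inj] at he2
      exact har (he2 ▸ hw)
    -- `A + B.erase b` is aperiodic, so it has at least |A + B| - 1 elements, and `b` can add only
    -- one new sum.
    have hle : (A ∩ coset R a).card ≤ 1 := by
      have w1 := dfc_le_one h.left_nonempty (h.erase_nonempty b) (h.aper_erase hb)
      have hdj : Disjoint (A + B.erase b) ((A ∩ coset R a).image (· + b)) := by
        rw [disjoint_right]
        intro z hz
        obtain ⟨x, hx, rfl⟩ := mem_image.1 hz
        exact huniq x hx
      have hsub : (A + B.erase b) ∪ (A ∩ coset R a).image (· + b) ⊆ A + B := by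
        refine union_subset (add_subset_add_left (erase_subset _ _)) ?_
        intro z hz
        obtain ⟨x, hx, rfl⟩ := mem_image.1 hz
        exact add_mem_add (mem_inter.1 hx).1 hb
      have c1 := card_le_card hsub
      rw [card_union_of_disjoint hdj, card_image_of_injective _ (add_left_injective b)] at c1
      have c6 := card_erase_add_one hb
      simp only [dfc] at w1 u3
      omega
    have haa : a ∈ A ∩ coset R a := mem_inter.2 ⟨ha, hR.self_mem_coset a⟩
    have hAe : A ∩ coset R a = {a} := (card_le_one_iff_subset_singleton.1 hle).elim fun y hy => by
      have := hy haa
      rw [mem_singleton] at this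
      subst this
      exact Subset.antisymm hy (singleton_subset_iff.2 haa)
    refine h.not_per_erase hR hR0 ha ?_
    rw [← sdiff_singleton_eq_erase, ← hAe, sdiff_inter_self_left]
    apply per_of_card_le hR
    have c1 := card_sdiff_coset_add hR ha
    have c2 := card_inter_add_card_sdiff A (coset R a)
    rw [hAe, card_singleton] at c2
    simp only [dfc] at hd1
    omega

/-! ### Duality with the negated complement of the sumset -/

/-- `C` is the complement of `-(A + B)`. -/
def NegCompl (A B C : Finset G) : Prop := ∀ x, x ∈ C ↔ -x ∉ A + B

section NegCompl

variable {A B C : Finset G}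

theorem NegCompl.comm (h : NegCompl A B C) : NegCompl B A C := by
  intro x
  rw [h x, add_comm A B]

/-- A point whose negative is outside A + C could be added to B without enlarging A + B; if it were
new, an aperiodic sum would have deficiency 2. -/
theorem NegCompl.swap (h : NegCompl A B C) (hA : A.Nonempty)
    (hap : Aper (A + B)) (hd : dfc A B = 1) : NegCompl A C B := by
  intro x
  constructor
  · intro hx hc
    obtain ⟨a, ha, c, hc, he⟩ := mem_add.1 hc
    refine (h c).1 hc ?_
    have : -c = a + x := by
      rw [eq_sub_of_add_eq' he]
      abel
    rw [this]
    exact add_mem_add ha hx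
  · intro hx
    by_contra hxB
    have e : A + insert x B = A + B := by
      refine Subset.antisymm ?_ (add_subset_add_left (subset_insert _ _))
      intro z hz
      obtain ⟨a, ha, y, hy, rfl⟩ := mem_add.1 hz
      rcases mem_insert.1 hy with rfl | hy
      · by_contra hc
        refine hx (mem_add.2 ⟨a, ha, -(a + y), (h _).2 (by rwa [neg_neg]), by abel⟩)
      · exact add_mem_add ha hy
    have := dfc_le_one hA (insert_nonempty x B) (e ▸ hap)
    simp only [dfc] at hd this
    rw [e, card_insert_of_notMem hxB] at this
    push_cast at this
    omega

theorem NegCompl.card [Fintype G] (h : NegCompl A B C) :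
    C.card + (A + B).card = Fintype.card G := by
  have : C.image (- ·) = (A + B)ᶜ := by
    ext x
    simp only [mem_image, mem_compl]
    constructor
    · rintro ⟨c, hc, rfl⟩
      exact (h c).1 hc
    · intro hx
      exact ⟨-x, (h _).2 (by rwa [neg_neg]), neg_neg x⟩
  rw [← card_image_of_injective C neg_injective, this, add_comm, card_add_card_compl]

theorem card_add_card_of_neg_notMem {H X Y : Finset G} {u : G} (hX : X ⊆ coset H u)
    (hH : FinSub H) (hY : Y ⊆ coset H (-u)) (h : ∀ x ∈ coset H u, x ∈ X ↔ -x ∉ Y) :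
    X.card + Y.card = H.card := by
  have : Y.image (- ·) = coset H u \ X := by
    ext x
    simp only [mem_image, mem_sdiff]
    constructor
    · rintro ⟨y, hy, rfl⟩
      have hm : -y ∈ coset H u := by
        have := hH.neg (mem_coset.1 (hY hy))
        rw [mem_coset]
        rwa [show -(y - -u) = -y - u by abel] at this
      refine ⟨hm, fun hc => (h _ hm).1 hc (by rwa [neg_neg])⟩
    · rintro ⟨hx, hxX⟩
      refine ⟨-x, ?_, neg_neg x⟩
      by_contra hc
      exact hxX ((h x hx).2 hc)
  rw [← card_image_of_injective Y neg_injective, this, add_comm, card_sdiff_add_card_eq_card hX,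
    card_coset]

/-- B inherits H-periodicity outside -a' - c' + H. Inside the distinguished cosets the
complementarity persists: the part of B is complementary to that of -(A + C), and the part of A + B
to that of -C. The two counts in H transfer criticality. -/
theorem Red.of_negCompl {H : Finset G} {a' c' : G} (hr : Red H A C a' c') (h : NegCompl A B C)
    (h' : NegCompl A C B) (hap : Aper (A + B)) (h0 : H ≠ {0}) : ∃ b, Red H A B a' b := by
  have hH := hr.finSub
  have hper : Per H (B \ coset H (-a' - c')) := by
    intro t ht x hx
    rw [mem_sdiff] at hx ⊢
    refine ⟨(h' _).2 fun hc => ?_, fun hc => hx.2 ?_⟩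
    · obtain ⟨a, ha, c, hc, he⟩ := mem_add.1 hc
      have hxe : -x = t + (a + c) := by
        rw [he]
        abel
      by_cases haa : a ∈ coset H a'
      · by_cases hcc : c ∈ coset H c'
        · refine hx.2 (mem_coset.2 ?_)
          have := hH.neg (hH.add ht (hH.add (mem_coset.1 haa) (mem_coset.1 hcc)))
          rwa [show -(t + (a - a' + (c - c'))) = x - (-a' - c') by
            rw [← neg_neg x, hxe]
            abel] at this
        · have := hr.per_right t ht c (mem_sdiff.2 ⟨hc, hcc⟩)
          refine (h' x).1 hx.1 (mem_add.2 ⟨a, ha, t + c, (mem_sdiff.1 this).1, ?_⟩)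
          rw [hxe]
          abel
      · have := hr.per_left t ht a (mem_sdiff.2 ⟨ha, haa⟩)
        refine (h' x).1 hx.1 (mem_add.2 ⟨t + a, (mem_sdiff.1 this).1, c, hc, ?_⟩)
        rw [hxe]
        abel
    · have := hH.add (hH.neg ht) (mem_coset.1 hc)
      rw [mem_coset]
      rwa [show -t + (t + x - (-a' - c')) = x - (-a' - c') by abel] at this
  have hne : ∃ b ∈ B, b ∈ coset H (-a' - c') := by
    by_contra! hc
    have e : B \ coset H (-a' - c') = B := sdiff_eq_self_of_disjoint (disjoint_left.2 hc)
    rw [e] at hper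
    exact h0 (hap.eq_bot hH (hper.add_right A))
  obtain ⟨b, hb, hbc⟩ := hne
  rw [← hH.coset_eq hbc] at hper
  have huniq : ∀ {x y}, x ∈ A → y ∈ B → x + y ∈ coset H (a' + b) →
      x ∈ coset H a' ∧ y ∈ coset H b := by
    intro x y hx hy hxy
    have hxa : x ∈ coset H a' := by
      by_contra hxa
      have hm : -(x + y + c') ∈ H := by
        have := hH.neg (hH.add (mem_coset.1 hxy) (mem_coset.1 hbc))
        rwa [show -(x + y - (a' + b) + (b - (-a' - c'))) = -(x + y + c') by abel] at this
      have := hr.per_left _ hm x (mem_sdiff.2 ⟨hx, hxa⟩)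
      exact (h' y).1 hy (mem_add.2 ⟨_, (mem_sdiff.1 this).1, c', hr.mem_right, by abel⟩)
    refine ⟨hxa, mem_coset.2 ?_⟩
    have := hH.sub (mem_coset.1 hxy) (mem_coset.1 hxa)
    rwa [show x + y - (a' + b) - (x - a') = y - b by abel] at this
  have sumsub : ∀ {X Y : Finset G} {x y}, X ⊆ coset H x → Y ⊆ coset H y →
      X + Y ⊆ coset H (x + y) := by
    intro X Y x y hX hY z hz
    obtain ⟨u, hu, v, hv, rfl⟩ := mem_add.1 hz
    have := hH.add (mem_coset.1 (hX hu)) (mem_coset.1 (hY hv))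
    rw [mem_coset]
    rwa [show u - x + (v - y) = u + v - (x + y) by abel] at this
  have hneg : ∀ {x u v}, v ∈ coset H (-u) → x ∈ coset H u → -x ∈ coset H v := by
    intro x u v hv hx
    have := hH.neg (hH.add (mem_coset.1 hx) (mem_coset.1 hv))
    rw [mem_coset]
    rwa [show -(x - u + (v - -u)) = -x - v by abel] at this
  have hb1 : a' + c' ∈ coset H (-b) := by
    have := hH.neg (hH.neg (mem_coset.1 hbc))
    rw [mem_coset]
    rwa [show - -(b - (-a' - c')) = a' + c' - -b by abel] at this
  have hb2 : c' ∈ coset H (-(a' + b)) := by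
    have := mem_coset.1 hb1
    rw [mem_coset]
    rwa [show a' + c' - -b = c' - -(a' + b) by abel] at this
  have e1 : (B ∩ coset H b).card + (A ∩ coset H a' + C ∩ coset H c').card = H.card := by
    refine card_add_card_of_neg_notMem inter_subset_right hH ?_ fun x hx => ?_
    · rw [← hH.coset_eq hb1]
      exact sumsub inter_subset_right inter_subset_right
    · rw [mem_inter, and_iff_left hx, h' x, not_iff_not]
      refine ⟨fun hm => ?_, fun hm => add_subset_add inter_subset_left inter_subset_left hm⟩
      obtain ⟨a, ha, c, hc, he⟩ := mem_add.1 hm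
      have := hr.uniq ha hc (he ▸ hneg hb1 hx)
      rw [← he]
      exact add_mem_add (mem_inter.2 ⟨ha, this.1⟩) (mem_inter.2 ⟨hc, this.2⟩)
  have e2 : (A ∩ coset H a' + B ∩ coset H b).card + (C ∩ coset H c').card = H.card := by
    refine card_add_card_of_neg_notMem (sumsub inter_subset_right inter_subset_right) hH ?_
      fun x hx => ?_
    · rw [← hH.coset_eq hb2]
      exact inter_subset_right
    · rw [mem_inter, and_iff_left (hneg hb2 hx), h (-x), neg_neg, not_not]
      refine ⟨fun hm => add_subset_add inter_subset_left inter_subset_left hm, fun hm => ?_⟩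
      obtain ⟨a, ha, y, hy, rfl⟩ := mem_add.1 hm
      have := huniq ha hy hx
      exact add_mem_add (mem_inter.2 ⟨ha, this.1⟩) (mem_inter.2 ⟨hy, this.2⟩)
  have := hr.card
  exact ⟨b, hH, hr.mem_left, hb, hr.per_left, hper, huniq, by omega⟩

theorem Crit.of_negCompl [Fintype G] (hc : Crit A B) (h : NegCompl A B C) (h2 : 2 ≤ C.card) :
    Crit A C := by
  have h' := h.swap hc.left_nonempty hc.aper hc.dfc_eq
  refine ⟨fun g hg => hc.aper g ?_, ?_, hc.two_le_left, h2, fun H a c hr h0 => ?_⟩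
  · intro x hx
    obtain ⟨a, ha, b, hb, rfl⟩ := mem_add.1 hx
    refine mem_add.2 ⟨a, ha, g + b, (h' _).2 fun hm => (h' b).1 hb ?_, by abel⟩
    have := hg _ hm
    rwa [show g + -(g + b) = -b by abel] at this
  · have h1 := h.card
    have h2 := h'.card
    have h3 := hc.dfc_eq
    simp only [dfc] at *
    omega
  · obtain ⟨b, hb⟩ := hr.of_negCompl h h' hc.aper h0
    exact hc.no_red H a b hb h0

end NegCompl

/-! ### Subgroups with A + R ≠ G in a finite group -/

section Covering

variable {A B C R : Finset G}

/-- Filling b + R keeps -c out of the sum, so the union has deficiency at most 1, and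
supermodularity gives B ∩ (b + R) at least the deficiency of R. This forces B ∩ (b + R) = {b} and
`dfc A R = 1`; the equality case then says that x + b ∉ A + B for every hole x of A in A + R. -/
theorem Crit.holes_of_notMem (h : Crit A B) (hC : Crit A C) (hn : NegCompl A B C)
    (hn' : NegCompl A C B) (hR : FinSub R) (hR0 : R ≠ {0}) (hpos : 1 ≤ dfc A R)
    (hmin : ∀ S ⊆ R, FinSub S → S ≠ {0} → S ≠ R → dfc A S < dfc A R) {b c : G} (hb : b ∈ B)
    (hc : c ∈ C) (hbc : -(b + c) ∉ A + R) :
    dfc A R = 1 ∧ ∀ x ∈ A + R, x ∉ A → -(x + b) ∈ C := by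
  have hcY : -c ∉ A + (B ∪ coset R b) := by
    rw [add_union, mem_union, not_or]
    refine ⟨(hn c).1 hc, fun hm => hbc ?_⟩
    rw [add_coset] at hm
    obtain ⟨x, hx, he⟩ := mem_image.1 hm
    rwa [neg_add, ← sub_eq_neg_add, ← he, add_sub_cancel_left]
  have h1 : dfc A (B ∪ coset R b) ≤ 1 := by
    obtain ⟨S, hS, hpS, hg, hle⟩ := exists_dfc_le h.left_nonempty
      (h.right_nonempty.mono (subset_union_left (s₂ := coset R b)))
    by_cases hS0 : S = {0}
    · refine dfc_le_one h.left_nonempty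
        (h.right_nonempty.mono (subset_union_left (s₂ := coset R b))) fun g hg' => ?_
      simpa [hS0] using hg g hg'
    · refine (dfc_le_stab hS hle).trans ((h.dfc_subgroup_nonpos _ S rfl hS hS0
        ⟨-c, fun hm => hcY ?_⟩).trans zero_le_one)
      rw [← hpS.add_eq hS, add_assoc]
      exact add_subset_add_left (add_subset_add_right subset_union_left) hm
  have h2 := dfc_union_coset A B R b
  have h3 := h.dfc_eq
  have hbb : b ∈ B ∩ coset R b := mem_inter.2 ⟨hb, hR.self_mem_coset b⟩
  -- Otherwise this part has the same sum with A as the whole coset, and counting makes it the whole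
  -- coset. But -b ∈ A + C + R, as R is deficient and (A, C) is critical, so -(b + r) ∈ A + C for
  -- some r ∈ R, although b + r ∈ B.
  have hnp : ¬ Per R (A + B ∩ coset R b) := by
    intro hp
    have hsub : B ∩ coset R b ⊆ coset R b := inter_subset_right
    have e : A + coset R b ⊆ A + B ∩ coset R b := by
      rw [← hp.add_eq hR, add_assoc]
      exact add_subset_add_left (coset_subset_add hbb)
    have c1 := card_le_card e
    rw [add_coset, card_image_of_injective _ (add_right_injective b)] at c1
    have c2 : coset R b ⊆ B := by
      rw [← eq_of_subset_of_card_le hsub (by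
        rw [card_coset]
        simp only [dfc] at h2 h1 h3
        omega)]
      exact inter_subset_left
    have hm : -b ∈ A + (C + R) := by
      by_contra hm
      have := hC.dfc_subgroup_nonpos _ R rfl hR hR0 ⟨-b, hm⟩
      omega
    obtain ⟨a, ha, _, hy, he⟩ := mem_add.1 hm
    obtain ⟨c', hc', r, hr, rfl⟩ := mem_add.1 hy
    have hbr : b + r ∈ B := c2 (mem_coset.2 (by simpa using hr))
    refine (hn' _).1 hbr ?_
    rw [neg_add, ← he]
    exact mem_add.2 ⟨a, ha, c', hc', by abel⟩
  have hone : dfc A R = 1 ∧ dfc A (B ∩ coset R b) = 1 := by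
    rcases dfc_piece_cases h.left_nonempty ⟨b, hbb⟩ hR inter_subset_right with
      h4 | h4 | h4 | ⟨S, hSR, hS, hS0, hle, hfull⟩
    · have := dfc_le_one h.left_nonempty ⟨b, hbb⟩ h4
      omega
    · omega
    · obtain ⟨y, hy⟩ := card_eq_one.1 h4
      rw [hy, dfc_singleton] at h2 ⊢
      omega
    · have := hmin S hSR hS hS0 fun hE => hnp (hfull hE.ge)
      omega
  refine ⟨hone.1, ?_⟩
  have hsingle : B ∩ coset R b = {b} := by
    by_contra hne
    have hlt : 2 ≤ (B ∩ coset R b).card := by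
      have := card_pos.2 ⟨b, hbb⟩
      by_contra hlt
      obtain ⟨y, hy⟩ := card_eq_one.1 (show (B ∩ coset R b).card = 1 by omega)
      rw [hy, mem_singleton] at hbb
      exact hne (hbb ▸ hy)
    obtain ⟨x, hx, hp⟩ := exists_per_erase h.left_nonempty hR hone.1.le
      (fun S hSR hS hS0 hne => by have := hmin S hSR hS hS0 hne; omega) inter_subset_right hlt hnp
      (by omega)
    exact h.not_per_erase hR hR0 hx hp
  have hsub := inter_subset_of_dfc_le (A := A) (X := B) (Y := coset R b) (by
    rw [dfc_coset]
    omega)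
  rw [hsingle] at hsub
  intro x hx hxA
  rw [hn, neg_neg]
  intro hm
  have hm' : x + b ∈ A + coset R b := by
    rw [add_coset]
    exact mem_image.2 ⟨x, hx, by abel⟩
  obtain ⟨a, ha, w, hw, he⟩ := mem_add.1 (hsub (mem_inter.2 ⟨hm, hm'⟩))
  rw [mem_singleton] at hw
  rw [hw, add_left_inj] at he
  exact hxA (he ▸ ha)

theorem Crit.holes (h : Crit A B) (hC : Crit A C) (hn : NegCompl A B C)
    (hn' : NegCompl A C B) (hR : FinSub R) (hR0 : R ≠ {0}) (hpos : 1 ≤ dfc A R)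
    (hmin : ∀ S ⊆ R, FinSub S → S ≠ {0} → S ≠ R → dfc A S < dfc A R) {z : G} (hz : z ∉ A + R) :
    dfc A R = 1 ∧ ∀ x ∈ A + R, x ∉ A → ∀ b ∈ B, -(x + b) ∈ C := by
  have hnA : NegCompl B C A :=
    hn.comm.swap h.right_nonempty h.symm.aper h.symm.dfc_eq
  have hzA : -z ∈ B + C := by
    by_contra hc
    exact hz (subset_add hR ((hnA z).2 hc))
  obtain ⟨b₁, hb₁, c₁, hc₁, he⟩ := mem_add.1 hzA
  have h₁ : -(b₁ + c₁) ∉ A + R := by rwa [he, neg_neg]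
  obtain ⟨hd, hh⟩ := h.holes_of_notMem hC hn hn' hR hR0 hpos hmin hb₁ hc₁ h₁
  refine ⟨hd, fun x hx hxA b hb => ?_⟩
  by_cases hex : ∃ c ∈ C, -(b + c) ∉ A + R
  · obtain ⟨c, hc, hbc⟩ := hex
    exact (h.holes_of_notMem hC hn hn' hR hR0 hpos hmin hb hc hbc).2 x hx hxA
  -- Here c ↦ -(b + c) embeds C into the holes, while x ↦ -(x + b₁) embeds the holes into C \ {c₁}.
  · push Not at hex
    have c1 : C.card ≤ ((A + R) \ A).card := by
      refine card_le_card_of_injOn (fun c => -(b + c)) (fun c hc => ?_) (fun c _ c' _ hcc => ?_)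
      · refine mem_coe.2 (mem_sdiff.2 ⟨hex c hc, fun hm => (hnA _).1 hm ?_⟩)
        rw [neg_neg]
        exact add_mem_add hb hc
      · simpa using hcc
    have c2 : ((A + R) \ A).card ≤ (C.erase c₁).card := by
      refine card_le_card_of_injOn (fun x => -(x + b₁)) (fun x hx => ?_) (fun c _ c' _ hcc => ?_)
      · have hx := mem_sdiff.1 (mem_coe.1 hx)
        refine mem_coe.2 (mem_erase.2 ⟨fun hc => h₁ ?_, hh x hx.1 hx.2⟩)
        rw [← hc]
        simpa using hx.1
      · simpa using hcc
    have := card_erase_add_one hc₁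
    omega

/-- Each hole x satisfies -(x + B) ⊆ C and -(x + C) ⊆ B, so the difference of two holes is a period
of A + B. Thus there is one hole, deficiency 1 gives |R| = 2, and A is R-periodic apart from one
point. -/
theorem Crit.subgroup_nonpos_of_negCompl (h : Crit A B) (hC : Crit A C) (hn : NegCompl A B C)
    (hn' : NegCompl A C B) (n : ℕ) : ∀ R : Finset G, R.card = n → FinSub R → R ≠ {0} →
    (∃ z, z ∉ A + R) → (∀ S, FinSub S → (∃ z, z ∉ A + S) → dfc A S ≤ dfc A R) →
    dfc A R ≤ 0 := by
  induction n using Nat.strong_induction_on with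
  | _ n ih =>
    intro R hcard hR hR0 ⟨z, hz⟩ hmax
    by_contra hpos
    have hmin : ∀ S ⊆ R, FinSub S → S ≠ {0} → S ≠ R → dfc A S < dfc A R := by
      intro S hSR hS hS0 hne
      by_contra hle
      have hzS : ∃ z, z ∉ A + S := ⟨z, fun hc => hz (add_subset_add_left hSR hc)⟩
      have := ih S.card (hcard ▸ card_lt_card (hSR.ssubset_of_ne hne)) S rfl hS hS0 hzS
        (fun T hT hzT => (hmax T hT hzT).trans (by omega))
      omega
    obtain ⟨hd, h1⟩ := h.holes hC hn hn' hR hR0 (by omega) hmin hz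
    obtain ⟨-, h2⟩ := hC.holes h hn' hn hR hR0 (by omega) hmin hz
    have huniq : ∀ x ∈ (A + R) \ A, ∀ y ∈ (A + R) \ A, x = y := by
      intro x hx y hy
      rw [mem_sdiff] at hx hy
      refine sub_eq_zero.1 (h.aper _ fun w hw => ?_)
      obtain ⟨a, ha, b, hb, rfl⟩ := mem_add.1 hw
      refine mem_add.2 ⟨a, ha, _, h2 y hy.1 hy.2 _ (h1 x hx.1 hx.2 b hb), by abel⟩
    have c1 := card_le_one.2 huniq
    have c2 := card_sdiff_add_card_eq_card (subset_add hR (X := A))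
    have c3 := hR.two_le_card hR0
    have c4 : R.card = 2 ∧ ((A + R) \ A).card = 1 := by
      simp only [dfc] at hd
      omega
    obtain ⟨x, hx⟩ := card_eq_one.1 c4.2
    have hxm : x ∈ (A + R) \ A := by simp [hx]
    rw [mem_sdiff] at hxm
    obtain ⟨a, ha, r, hr, rfl⟩ := mem_add.1 hxm.1
    have haa : a ∈ A ∩ coset R a := mem_inter.2 ⟨ha, hR.self_mem_coset a⟩
    have c5 : (A ∩ coset R a).card < (coset R a).card := by
      refine card_lt_card ((ssubset_iff_of_subset inter_subset_right).2
        ⟨a + r, mem_coset.2 (by simpa using hr), fun hc => hxm.2 (mem_inter.1 hc).1⟩)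
    rw [card_coset] at c5
    have c6 := card_pos.2 ⟨a, haa⟩
    obtain ⟨w, hw⟩ := card_eq_one.1 (show (A ∩ coset R a).card = 1 by omega)
    have hwa : a = w := by rwa [hw, mem_singleton] at haa
    subst hwa
    refine h.not_per_erase hR hR0 ha ?_
    rw [← sdiff_singleton_eq_erase, ← hw, sdiff_inter_self_left]
    apply per_of_card_le hR
    have c7 := card_sdiff_coset_add hR ha
    have c8 := card_inter_add_card_sdiff A (coset R a)
    omega

end Covering

/-- Finite subgroups are never deficient for a critical pair without reductions, unless they
cover the group. -/
theorem Crit.subgroup_nonpos {A B : Finset G} (h : Crit A B) {u v : G} (huv : u ≠ v)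
    (hu : u ∉ A + B) (hv : v ∉ A + B) {R : Finset G} (hR : FinSub R) (hR0 : R ≠ {0})
    (hz : ∃ z, z ∉ A + R) : dfc A R ≤ 0 := by
  classical
  rcases finite_or_infinite G with hfin | hinf
  · have := Fintype.ofFinite G
    obtain ⟨C, hC⟩ : ∃ C, NegCompl A B C := ⟨univ.filter (fun x => -x ∉ A + B), fun x => by simp⟩
    have h2 : 2 ≤ C.card := by
      refine one_lt_card.2 ⟨-u, (hC _).2 (by rwa [neg_neg]), -v, (hC _).2 (by rwa [neg_neg]), ?_⟩
      simpa using huv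
    have hn' := hC.swap h.left_nonempty h.aper h.dfc_eq
    by_contra hpos
    obtain ⟨m, ⟨Q, hQ, hzQ, rfl⟩, hmax⟩ := Int.exists_greatest_of_bdd
      (P := fun m => ∃ Q, FinSub Q ∧ (Q ≠ {0} ∧ ∃ z, z ∉ A + Q) ∧ dfc A Q = m)
      ⟨A.card, by rintro _ ⟨Q, -, -, rfl⟩; exact dfc_le_card h.left_nonempty⟩
      ⟨_, R, hR, ⟨hR0, hz⟩, rfl⟩
    have hRQ := hmax _ ⟨R, hR, ⟨hR0, hz⟩, rfl⟩
    have := h.subgroup_nonpos_of_negCompl (h.of_negCompl hC h2) hC hn' _ Q rfl hQ hzQ.1 hzQ.2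
      fun S hS hzS => by
        by_cases hS0 : S = {0}
        · rw [hS0, dfc_singleton]
          omega
        · exact hmax _ ⟨S, hS, ⟨hS0, hzS⟩, rfl⟩
    omega
  · exact h.dfc_subgroup_nonpos _ R rfl hR hR0 (Infinite.exists_notMem_finset _)

/-! ### Smallest deficient sets -/

/-- No nonzero finite subgroup is deficient, unless it covers the group. -/
def Residual (X : Finset G) : Prop :=
  ∀ T, FinSub T → T ≠ {0} → (∃ z, z ∉ X + T) → dfc X T ≤ 0

/-- A deficient set with at least two elements and a large complement of its sum with `X`. -/
structure Deficient (X Y : Finset G) : Prop where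
  two_le : 2 ≤ Y.card
  pos : 1 ≤ dfc X Y
  exists_notMem : ∃ u v, u ≠ v ∧ u ∉ X + Y ∧ v ∉ X + Y

/-- Two distinct translates of `M` share at most one element. -/
def Sidon (M : Finset G) : Prop := ∀ g, g ≠ 0 → (M ∩ coset M g).card ≤ 1

section Residual

variable {X Y : Finset G}

theorem Residual.aper_of_pos (h : Residual X) (hX : X.Nonempty) (hY : Y.Nonempty) {z : G}
    (hz : z ∉ X + Y) (hpos : 1 ≤ dfc X Y) : Aper (X + Y) := by
  obtain ⟨S, hS, hpS, hg, hle⟩ := exists_dfc_le hX hY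
  by_cases hS0 : S = {0}
  · intro g hg'
    simpa [hS0] using hg g hg'
  · obtain ⟨y, hy⟩ := hY
    have := h S hS hS0 ⟨z - y, fun hm => hz ?_⟩
    · have := dfc_le_stab hS hle
      omega
    · obtain ⟨x, hx, s, hs, he⟩ := mem_add.1 hm
      have := hpS s hs _ (add_mem_add hx hy)
      rwa [show s + (x + y) = z by
        rw [← sub_add_cancel z y, ← he]
        abel] at this

theorem Residual.dfc_le_one (h : Residual X) (hX : X.Nonempty) (hY : Y.Nonempty) {z : G}
    (hz : z ∉ X + Y) : dfc X Y ≤ 1 := by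
  by_contra hlt
  have := LevStructure.dfc_le_one hX hY (h.aper_of_pos hX hY hz (by omega))
  omega

theorem Deficient.nonempty (h : Deficient X Y) : Y.Nonempty :=
  card_pos.1 (by have := h.two_le; omega)

theorem exists_minimal_deficient (h : Deficient X Y) :
    ∃ M, Deficient X M ∧ ∀ N, Deficient X N → M.card ≤ N.card := by
  classical
  have hex : ∃ n, ∃ M, Deficient X M ∧ M.card = n := ⟨_, Y, h, rfl⟩
  obtain ⟨M, hM, hcard⟩ := Nat.find_spec hex
  exact ⟨M, hM, fun N hN => hcard ▸ Nat.find_min' hex ⟨N, hN, rfl⟩⟩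

/-- Here `coset M g` is the translate g + M. If it met M twice, minimality would give the
intersection deficiency at most 0 (or make g a period), so the union would have deficiency at least
2 and its sum with X would be G. The negated complement C of X + M is then deficient, so |C| ≥ |M|;
the count for the union says |C| < |M|. -/
theorem Residual.sidon (h : Residual X) (hX : X.Nonempty) {M : Finset G} (hM : Deficient X M)
    (hmin : ∀ N, Deficient X N → M.card ≤ N.card) : Sidon M := by
  intro g hg
  by_contra! hlt
  obtain ⟨u, v, huv, hu, hv⟩ := hM.exists_notMem
  have hsub : X + M ∩ coset M g ⊆ X + M := add_subset_add_left inter_subset_left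
  have hI : dfc X (M ∩ coset M g) ≤ 0 := by
    by_contra hpos
    have hle := hmin _ ⟨hlt, by omega, u, v, huv, fun hc => hu (hsub hc), fun hc => hv (hsub hc)⟩
    have e := eq_of_subset_of_card_le inter_subset_left hle
    have e2 : coset M g = M :=
      (eq_of_subset_of_card_le (inter_eq_left.1 e) (card_coset M g).le).symm
    refine hg (h.aper_of_pos hX hM.nonempty hu hM.pos g fun x hx => ?_)
    obtain ⟨a, ha, m, hm, rfl⟩ := mem_add.1 hx
    refine mem_add.2 ⟨a, ha, g + m, ?_, by abel⟩
    rw [← e2, mem_coset]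
    simpa using hm
  have h1 := dfc_add_dfc_le X M (coset M g)
  rw [dfc_coset] at h1
  have h2 := hM.pos
  have hcover : ∀ z, z ∈ X + (M ∪ coset M g) := by
    intro z
    by_contra hz
    have := h.dfc_le_one hX (hM.nonempty.mono subset_union_left) hz
    omega
  have hfin : Finite G := Set.finite_univ_iff.1
    ((X + (M ∪ coset M g)).finite_toSet.subset fun z _ => mem_coe.2 (hcover z))
  have := Fintype.ofFinite G
  obtain ⟨C, hC⟩ : ∃ C, NegCompl X M C := ⟨univ.filter (fun x => -x ∉ X + M), fun x => by simp⟩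
  have hXC : ∀ m ∈ M, -m ∉ X + C := by
    intro m hm hc
    obtain ⟨x, hx, c, hcc, he⟩ := mem_add.1 hc
    refine (hC c).1 hcc ?_
    rw [show -c = x + m by rw [eq_sub_of_add_eq' he]; abel]
    exact add_mem_add hx hm
  have c1 := hC.card
  have c2 : M.card + (X + C).card ≤ Fintype.card G := by
    rw [← card_image_of_injective M neg_injective, ← card_union_of_disjoint]
    · exact card_le_univ _
    · rw [disjoint_left]
      intro z hz
      obtain ⟨m, hm, rfl⟩ := mem_image.1 hz
      exact hXC m hm
  have c3 : (X + (M ∪ coset M g)).card = Fintype.card G := by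
    rw [eq_univ_of_forall hcover, card_univ]
  have c4 := card_union_add_card_inter M (coset M g)
  rw [card_coset] at c4
  obtain ⟨p, hp, q, hq, hpq⟩ := one_lt_card.1 hM.two_le
  have h3 := hmin C ⟨one_lt_card.2 ⟨-u, (hC _).2 (by rwa [neg_neg]), -v,
    (hC _).2 (by rwa [neg_neg]), by simpa using huv⟩, by
      simp only [dfc] at *
      omega, -p, -q, by simpa using hpq, hXC p hp, hXC q hq⟩
  simp only [dfc] at h1 hI h2
  omega

end Residual

/-- Each new translate of M meets every earlier one at most once, so |M + N| ≥ |M||N| - |N|(|N| -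
1)/2. -/
theorem Sidon.card_mul_card_le {M : Finset G} (h : Sidon M) (N : Finset G) :
    2 * (M.card : ℤ) * N.card ≤ 2 * (M + N).card + N.card * (N.card - 1) := by
  induction N using Finset.induction_on with
  | empty => simp
  | insert n N hn ih =>
    have e : M + insert n N = coset M n ∪ (M + N) := by
      rw [insert_eq, add_union, add_singleton]
      congr 1
      ext x
      rw [mem_coset, mem_vadd_finset]
      constructor
      · rintro ⟨y, hy, rfl⟩
        simpa using hy
      · intro hx
        exact ⟨_, hx, by simp⟩
    have h1 : (coset M n ∩ (M + N)).card ≤ N.card * 1 := by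
      have : coset M n ∩ (M + N) ⊆ N.biUnion fun y => coset (M ∩ coset M (n - y)) y := by
        intro x hx
        rw [mem_inter, mem_coset] at hx
        obtain ⟨m, hm, y, hy, rfl⟩ := mem_add.1 hx.2
        refine mem_biUnion.2 ⟨y, hy, mem_coset.2 (mem_inter.2 ⟨by simpa using hm, ?_⟩)⟩
        rw [mem_coset]
        rw [show m + y - y - (n - y) = m + y - n by abel]
        exact hx.1
      refine (card_le_card this).trans (card_biUnion_le_card_mul _ _ _ fun y hy => ?_)
      rw [card_coset]
      exact h _ (sub_ne_zero.2 fun hc => hn (hc ▸ hy))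
    have h2 := card_union_add_card_inter (coset M n) (M + N)
    rw [card_coset, ← e] at h2
    rw [card_insert_of_notMem hn]
    push_cast
    zify at h1 h2
    nlinarith

/-- If |N| ≤ |M|, the previous bound gives 2(|M| - 1) ≤ |N| ≤ |M|, so |M| ≤ 2. -/
theorem Sidon.card_lt {M N : Finset G} (h : Sidon M) (h3 : 3 ≤ M.card) (h2 : 2 ≤ N.card)
    (hd : 1 ≤ dfc M N) : M.card < N.card := by
  by_contra! hle
  have h1 := h.card_mul_card_le N
  simp only [dfc] at hd
  zify at h3 h2 hle
  nlinarith

namespace Crit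

variable {A B : Finset G}

/-- L has positive deficiency, so A + L = G. Every w - b is missing from A and hence lies in the
only incomplete coset a + L; if L ≠ G, this puts B in one coset, against `not_subset_coset`. -/
theorem mem_of_per_sdiff (h : Crit A B) (hres : Residual A) {w : G} (hw : w ∉ A + B)
    {L : Finset G} (hL : FinSub L) (hL0 : L ≠ {0}) {a : G} (ha : a ∈ A)
    (hp : Per L (A \ coset L a)) (z : G) : z ∈ L := by
  have hpos : 0 < (A ∩ coset L a).card :=
    card_pos.2 ⟨a, mem_inter.2 ⟨ha, hL.self_mem_coset a⟩⟩
  have hd := dfc_of_per_sdiff hL ha hp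
  have hcover : ∀ y, y ∈ A + L := by
    intro y
    by_contra hy
    have := hres L hL hL0 ⟨y, hy⟩
    omega
  by_contra hz
  refine h.not_subset_coset hL hz (w - a) fun b hb => ?_
  have hwb : w - b ∉ A := fun hc => hw (mem_add.2 ⟨_, hc, b, hb, by abel⟩)
  obtain ⟨x, hx, l, hl, he⟩ := mem_add.1 (hcover (w - b))
  have hxa : x ∈ coset L a := by
    by_contra hxa
    have := hp l hl x (mem_sdiff.2 ⟨hx, hxa⟩)
    rw [add_comm, he] at this
    exact hwb (mem_sdiff.1 this).1
  have := hL.neg (hL.add (mem_coset.1 hxa) hl)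
  rw [mem_coset]
  rwa [show -(x - a + l) = b - (w - a) by
    rw [show -(x - a + l) = a - (x + l) by abel, he]
    abel] at this

theorem exists_card_union_coset_le (h : Crit A B) (hres : Residual A) {u v : G} (huv : u ≠ v)
    (hu : u ∉ A + B) (hv : v ∉ A + B) : ∃ d, d ≠ 0 ∧ (A ∪ coset A d).card ≤ A.card + 1 := by
  obtain ⟨M, hM, hmin⟩ := exists_minimal_deficient
    (⟨h.two_le_right, h.dfc_eq.ge, u, v, huv, hu, hv⟩ : Deficient A B)
  have hS := hres.sidon h.left_nonempty hM hmin
  obtain ⟨p, q, hpq, hpM, hqM⟩ := hM.exists_notMem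
  have hcard : M.card < 3 := by
    by_contra! h3
    -- A deficient T is larger than M by `Sidon.card_lt`, so M lies in one T-coset. Then (A, M) has
    -- a reduction inside T, which `mem_of_per_sdiff` identifies with G.
    have hresM : Residual M := by
      intro T hT hT0 ⟨z, hz⟩
      by_contra hpos
      have hlt := hS.card_lt h3 (hT.two_le_card hT0) (by omega)
      obtain ⟨m, hm⟩ := hM.nonempty
      have hsub : M ⊆ coset T m := by
        by_contra hsub
        obtain ⟨y, hy, hyT⟩ := not_subset.1 hsub
        have := two_mul_card_le hT hm hy hyT
        simp only [dfc] at hpos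
        omega
      have e : M \ coset T m = ∅ := sdiff_eq_empty_iff_subset.2 hsub
      have e2 : M + T = coset T m := by
        apply Subset.antisymm
        · rw [← (hT.per_coset m).add_eq hT]
          exact add_subset_add_right hsub
        · exact coset_subset_add hm
      obtain ⟨L, a, hL, hL0, hr⟩ := exists_red_of_piece hT
        (hres.aper_of_pos h.left_nonempty hM.nonempty hpM hM.pos) hM.pos hm
        (by rw [e, add_empty]; intro _ _ _ hx; simp at hx) (by rw [e2, dfc_coset])
        (by rw [inter_eq_left.2 hsub]; exact hM.two_le)
      have := h.mem_of_per_sdiff hres hu hr.finSub hL0 hr.mem_left hr.per_left (z - m)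
      exact hz (mem_add.2 ⟨m, hm, _, hL this, by abel⟩)
    obtain ⟨N, hN, hminN⟩ := exists_minimal_deficient
      (⟨h.two_le_left, by rw [dfc_comm]; exact hM.pos, p, q, hpq, by rwa [add_comm],
        by rwa [add_comm]⟩ : Deficient M A)
    have h4 := hS.card_lt h3 hN.two_le hN.pos
    have h5 := (hresM.sidon hM.nonempty hN hminN).card_lt (N := M) (by omega) hM.two_le
      (by rw [dfc_comm]; exact hN.pos)
    omega
  have hM2 := hM.two_le
  obtain ⟨x, y, hxy, rfl⟩ := card_eq_two.1 (show M.card = 2 by omega)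
  refine ⟨y - x, sub_ne_zero.2 hxy.symm, ?_⟩
  have hpos := hM.pos
  have : coset (A ∪ coset A (y - x)) x ⊆ A + {x, y} := by
    intro z hz
    rw [mem_coset, mem_union, mem_coset] at hz
    rcases hz with hz | hz
    · exact mem_add.2 ⟨_, hz, x, by simp, by abel⟩
    · exact mem_add.2 ⟨_, hz, y, by simp, by abel⟩
  have := card_le_card this
  rw [card_coset] at this
  simp only [dfc] at hpos
  omega

end Crit

/-! ### Arithmetic progressions -/

section Progression

variable {X : Finset G} {d e : G}

theorem exists_last (hcard : (X ∪ coset X d).card ≤ X.card + 1) (hns : ∃ x ∈ X, d + x ∉ X) :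
    ∃ e ∈ X, d + e ∉ X ∧ ∀ x ∈ X, x ≠ e → d + x ∈ X := by
  obtain ⟨e, he, hde⟩ := hns
  refine ⟨e, he, hde, fun x hx hxe => ?_⟩
  by_contra hdx
  have hsub : insert (d + x) (insert (d + e) X) ⊆ X ∪ coset X d := by
    intro z hz
    simp only [mem_insert] at hz
    rw [mem_union, mem_coset]
    rcases hz with rfl | rfl | hz
    · right
      simpa using hx
    · right
      simpa using he
    · exact Or.inl hz
  have := card_le_card hsub
  rw [card_insert_of_notMem (by simpa [hxe] using hdx), card_insert_of_notMem hde] at this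
  omega

theorem nsmul_add_mem (h : ∀ x ∈ X, d + x ∈ X) (n : ℕ) {x : G} (hx : x ∈ X) : n • d + x ∈ X := by
  induction n with
  | zero => simpa using hx
  | succ n ih =>
    rw [succ_nsmul', add_assoc]
    exact h _ ih

/-- Walk back from `e` by steps of `d` until leaving X. The rest of X is closed under adding `d`:
impossible for a nonempty finite set if `d` has infinite order, and leading back to `e` if the
multiples of `d` exhaust G. -/
theorem exists_progression (he : e ∈ X) (hde : d + e ∉ X) (hX : ∀ x ∈ X, x ≠ e → d + x ∈ X)
    (hgen : addOrderOf d = 0 ∨ ∀ g : G, ∃ n : ℕ, g = n • d) :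
    ∃ x₀, X = (range X.card).image fun i => x₀ + i • d := by
  classical
  have hne : ∀ {i j : ℕ}, i < j → (∀ l < j, e - l • d ∈ X) → e - i • d ≠ e - j • d := by
    intro i j hij hl heq
    have h0 : (j - i) • d = 0 := by
      rw [sub_right_inj] at heq
      rw [sub_nsmul _ hij.le, ← heq, add_neg_cancel]
    refine hde ?_
    have := hl (j - i - 1) (by omega)
    rwa [show e - (j - i - 1) • d = d + e by
      have h1 : (j - i) • d = (j - i - 1) • d + d := by
        rw [← succ_nsmul]
        congr 1
        omega
      rw [h0] at h1
      rw [eq_neg_of_add_eq_zero_left h1.symm]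
      abel] at this
  have hex : ∃ k : ℕ, e - k • d ∉ X := by
    by_contra! hc
    refine not_injective_infinite_finite (fun k : ℕ => (⟨e - k • d, hc k⟩ : X)) fun i j hij => ?_
    have hij := congrArg Subtype.val hij
    rcases lt_trichotomy i j with hlt | rfl | hlt
    · exact absurd hij (hne hlt fun l _ => hc l)
    · rfl
    · exact absurd hij.symm (hne hlt fun l _ => hc l)
  set k := Nat.find hex with hk
  have hkX : e - k • d ∉ X := Nat.find_spec hex
  have hkl : ∀ l < k, e - l • d ∈ X := fun l hl => not_not.1 (Nat.find_min hex hl)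
  have hk0 : 0 < k := by
    rw [Nat.pos_iff_ne_zero]
    intro h0
    rw [h0, zero_nsmul, sub_zero] at hkX
    exact hkX he
  set I := (range k).image fun i => e - i • d with hI
  have hIX : I ⊆ X := by
    intro x hx
    obtain ⟨i, hi, rfl⟩ := mem_image.1 hx
    exact hkl i (mem_range.1 hi)
  have heI : e ∈ I := mem_image.2 ⟨0, mem_range.2 hk0, by simp⟩
  have hstab : ∀ x ∈ X \ I, d + x ∈ X \ I := by
    intro x hx
    rw [mem_sdiff] at hx ⊢
    refine ⟨hX x hx.1 fun hc => hx.2 (hc ▸ heI), fun hc => ?_⟩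
    obtain ⟨i, hi, hie⟩ := mem_image.1 hc
    have hxe : x = e - (i + 1) • d := by
      rw [succ_nsmul, ← sub_sub, hie]
      abel
    rcases (Nat.succ_le_of_lt (mem_range.1 hi)).lt_or_eq with hlt | heq
    · exact hx.2 (mem_image.2 ⟨i + 1, mem_range.2 hlt, hxe.symm⟩)
    · rw [← heq] at hkX
      exact hkX (hxe ▸ hx.1)
  have hempty : X \ I = ∅ := by
    rw [eq_empty_iff_forall_notMem]
    intro x hx
    rcases hgen with h0 | hgen
    · refine not_injective_infinite_finite
        (fun n : ℕ => (⟨n • d + x, nsmul_add_mem hstab n hx⟩ : (X \ I : Finset G)))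
        fun i j hij => ?_
      have hij := add_right_cancel (congrArg Subtype.val hij)
      exact injective_nsmul_iff_not_isOfFinAddOrder.2 (addOrderOf_eq_zero_iff.1 h0) hij
    · obtain ⟨n, hn⟩ := hgen (e - x)
      have := nsmul_add_mem hstab n hx
      rw [← hn, sub_add_cancel] at this
      exact (mem_sdiff.1 this).2 heI
  have hXI : X = I := Subset.antisymm (sdiff_eq_empty_iff_subset.1 hempty) hIX
  have hcard : X.card = k := by
    rw [hXI, hI, card_image_of_injOn, card_range]
    intro i hi j hj hij
    have hi := mem_range.1 (mem_coe.1 hi)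
    have hj := mem_range.1 (mem_coe.1 hj)
    rcases lt_trichotomy i j with hlt | rfl | hlt
    · exact absurd hij (hne hlt fun l hl => hkl l (hl.trans hj))
    · rfl
    · exact absurd hij.symm (hne hlt fun l hl => hkl l (hl.trans hi))
  refine ⟨e - (k - 1) • d, ?_⟩
  rw [hcard]
  conv_lhs => rw [hXI, hI]
  have hflip : ∀ i < k, e - (k - 1) • d + i • d = e - (k - 1 - i) • d := by
    intro i hi
    have : (k - 1) • d = (k - 1 - i) • d + i • d := by
      rw [← add_nsmul]
      congr 1
      omega
    rw [this]
    abel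
  ext x
  simp only [mem_image, mem_range]
  constructor
  · rintro ⟨i, hi, rfl⟩
    refine ⟨k - 1 - i, by omega, ?_⟩
    rw [hflip _ (by omega)]
    congr 2
    omega
  · rintro ⟨i, hi, rfl⟩
    exact ⟨k - 1 - i, by omega, (hflip i hi).symm⟩

/-- Adding progressions of growing length increases the size until the sum is periodic. -/
theorem card_add_progression (B : Finset G) (n : ℕ)
    (h : ∃ x ∈ B + (range (n + 1)).image (fun i => i • d),
      d + x ∉ B + (range (n + 1)).image (fun i => i • d)) :
    (B ∪ coset B d).card + n ≤ (B + (range (n + 2)).image (fun i => i • d)).card := by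
  have hstep : ∀ m, ∀ x ∈ B + (range (m + 1)).image (fun i => i • d),
      d + x ∈ B + (range (m + 2)).image (fun i => i • d) := by
    intro m x hx
    obtain ⟨b, hb, _, hy, rfl⟩ := mem_add.1 hx
    obtain ⟨i, hi, rfl⟩ := mem_image.1 hy
    refine mem_add.2 ⟨b, hb, (i + 1) • d, mem_image.2 ⟨i + 1, ?_, rfl⟩, ?_⟩
    · rw [mem_range] at *
      omega
    · rw [succ_nsmul]
      abel
  have hmono : ∀ m, B + (range (m + 1)).image (fun i => i • d) ⊆
      B + (range (m + 2)).image (fun i => i • d) := fun m =>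
    add_subset_add_left (image_subset_image (range_subset_range.2 (by omega)))
  induction n with
  | zero =>
    rw [add_zero]
    apply card_le_card
    intro x hx
    rw [mem_union, mem_coset] at hx
    rcases hx with hx | hx
    · exact mem_add.2 ⟨x, hx, 0, mem_image.2 ⟨0, by simp⟩, by simp⟩
    · exact mem_add.2 ⟨_, hx, d, mem_image.2 ⟨1, by simp⟩, by simp⟩
  | succ n ih =>
    have h1 := ih (by
      by_contra! hc
      obtain ⟨x, hx, hdx⟩ := h
      refine hdx ?_
      obtain ⟨b, hb, _, hy, rfl⟩ := mem_add.1 hx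
      obtain ⟨i, hi, rfl⟩ := mem_image.1 hy
      by_cases hin : i < n + 1
      · exact hstep n _ (add_mem_add hb (mem_image.2 ⟨i, mem_range.2 hin, rfl⟩))
      · have hi' : i = n + 1 := by
          rw [mem_range] at hi
          omega
        subst hi'
        have := hc _ (add_mem_add hb (mem_image.2 ⟨n, by simp, rfl⟩))
        have := hstep n _ this
        rwa [show d + (b + (n + 1) • d) = d + (d + (b + n • d)) by
          rw [succ_nsmul]
          abel])
    have h2 : B + (range (n + 2)).image (fun i => i • d) ⊂
        B + (range (n + 3)).image (fun i => i • d) := by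
      refine (ssubset_iff_of_subset (hmono (n + 1))).2 ?_
      obtain ⟨x, hx, hdx⟩ := h
      exact ⟨d + x, hstep (n + 1) x hx, hdx⟩
    have := card_lt_card h2
    have e : n + 1 + 2 = n + 3 := rfl
    rw [e]
    omega

end Progression

/-- A critical pair without reductions whose sumset misses two points consists of progressions. -/
theorem Crit.exists_progression {A B : Finset G} (h : Crit A B) {u v : G} (huv : u ≠ v)
    (hu : u ∉ A + B) (hv : v ∉ A + B) :
    ∃ d, (addOrderOf d = 0 ∨ A.card + B.card - 1 ≤ addOrderOf d) ∧
      (∃ x₀, A = (range A.card).image fun i => x₀ + i • d) ∧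
      ∃ y₀, B = (range B.card).image fun i => y₀ + i • d := by
  have hres : Residual A := fun T hT hT0 hz => h.subgroup_nonpos huv hu hv hT hT0 hz
  obtain ⟨d, hd0, hdA⟩ := h.exists_card_union_coset_le hres huv hu hv
  have hns : ∃ x ∈ A + B, d + x ∉ A + B := by
    by_contra! hc
    exact hd0 (h.aper d hc)
  have hnsA : ∃ x ∈ A, d + x ∉ A := by
    by_contra! hc
    obtain ⟨x, hx, hdx⟩ := hns
    obtain ⟨a, ha, b, hb, rfl⟩ := mem_add.1 hx
    refine hdx ?_
    rw [← add_assoc]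
    exact add_mem_add (hc a ha) hb
  have hnsB : ∃ x ∈ B, d + x ∉ B := by
    by_contra! hc
    obtain ⟨x, hx, hdx⟩ := hns
    obtain ⟨a, ha, b, hb, rfl⟩ := mem_add.1 hx
    exact hdx (mem_add.2 ⟨a, ha, d + b, hc b hb, by abel⟩)
  obtain ⟨e, heA, hde, hlast⟩ := exists_last hdA hnsA
  -- For `d` of finite order, `hlast` makes A \ (e + ⟨d⟩) periodic under ⟨d⟩, so ⟨d⟩ = G by
  -- `mem_of_per_sdiff`.
  have hgen : addOrderOf d = 0 ∨
      0 < addOrderOf d ∧ ∀ g : G, g ∈ (range (addOrderOf d)).image (fun i => i • d) := by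
    rcases Nat.eq_zero_or_pos (addOrderOf d) with h0 | hpos
    · exact Or.inl h0
    right
    have hmem : ∀ n : ℕ, n • d ∈ (range (addOrderOf d)).image (fun i => i • d) := fun n =>
      mem_image.2 ⟨n % addOrderOf d, mem_range.2 (Nat.mod_lt _ hpos), mod_addOrderOf_nsmul d n⟩
    have hD : FinSub ((range (addOrderOf d)).image (fun i => i • d)) := by
      refine ⟨by simpa using hmem 0, fun {x y} hx hy => ?_, fun {x} hx => ?_⟩
      · obtain ⟨i, -, rfl⟩ := mem_image.1 hx
        obtain ⟨j, -, rfl⟩ := mem_image.1 hy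
        rw [← add_nsmul]
        exact hmem _
      · obtain ⟨i, hi, rfl⟩ := mem_image.1 hx
        have hi := mem_range.1 hi
        have := hmem (addOrderOf d - i)
        rwa [sub_nsmul _ hi.le, addOrderOf_nsmul_eq_zero, zero_add] at this
    refine ⟨hpos, h.mem_of_per_sdiff hres hu hD (fun hc => hd0 ?_) heA fun t ht x hx => ?_⟩
    · have := hmem 1
      rw [hc] at this
      simpa using this
    · obtain ⟨i, -, rfl⟩ := mem_image.1 ht
      refine nsmul_add_mem (fun y hy => ?_) i hx
      rw [mem_sdiff] at hy ⊢
      refine ⟨hlast y hy.1 fun hc => hy.2 (hc ▸ hD.self_mem_coset y), fun hc => hy.2 ?_⟩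
      refine hD.coset_trans (mem_coset.2 ?_) hc
      have := hD.neg (hmem 1)
      rwa [one_nsmul, show -d = y - (d + y) by abel] at this
  have hgen' : addOrderOf d = 0 ∨ ∀ g : G, ∃ n : ℕ, g = n • d :=
    hgen.imp_right fun hg g => by
      obtain ⟨i, -, hi⟩ := mem_image.1 (hg.2 g)
      exact ⟨i, hi.symm⟩
  obtain ⟨x₀, hx₀⟩ := LevStructure.exists_progression heA hde hlast hgen'
  have hd := h.dfc_eq
  have h2 := h.two_le_left
  -- With |A| = n + 2, `card_add_progression` gives |B ∪ (d + B)| + n ≤ |A + B| = |B| + n + 1.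
  have hdB : (B ∪ coset B d).card ≤ B.card + 1 := by
    obtain ⟨n, hn⟩ := Nat.exists_eq_add_of_le' h2
    have hsum : A + B = coset (B + (range (n + 2)).image (fun i => i • d)) x₀ := by
      conv_lhs => rw [hx₀, hn]
      ext z
      rw [mem_coset, mem_add, mem_add]
      simp only [mem_image]
      constructor
      · rintro ⟨_, ⟨i, hi, rfl⟩, b, hb, rfl⟩
        exact ⟨b, hb, _, ⟨i, hi, rfl⟩, by abel⟩
      · rintro ⟨b, hb, _, ⟨i, hi, rfl⟩, he⟩
        refine ⟨_, ⟨i, hi, rfl⟩, b, hb, ?_⟩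
        rw [eq_add_of_sub_eq he.symm]
        abel
    have := card_add_progression (d := d) B n (by
      by_contra! hc
      obtain ⟨x, hx, hdx⟩ := hns
      rw [hsum, mem_coset] at hx hdx
      refine hdx ?_
      obtain ⟨b, hb, _, hy, he⟩ := mem_add.1 hx
      obtain ⟨i, hi, rfl⟩ := mem_image.1 hy
      rw [add_sub_assoc, ← he]
      by_cases hin : i < n + 1
      · have := hc _ (add_mem_add hb (mem_image.2 ⟨i, mem_range.2 hin, rfl⟩))
        exact add_subset_add_left (image_subset_image (range_subset_range.2 (by omega))) this
      · have hi' : i = n + 1 := by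
          rw [mem_range] at hi
          omega
        subst hi'
        have h4 := hc _ (hc _ (add_mem_add hb (mem_image.2 ⟨n, by simp, rfl⟩)))
        rw [show d + (b + (n + 1) • d) = d + (d + (b + n • d)) by
          rw [succ_nsmul]
          abel]
        exact add_subset_add_left (image_subset_image (range_subset_range.2 (by omega))) h4)
    have hc := congrArg Finset.card hsum
    rw [card_coset] at hc
    simp only [dfc] at hd
    omega
  obtain ⟨f, hfB, hdf, hlastB⟩ := exists_last hdB hnsB
  refine ⟨d, hgen.imp_right fun hg => ?_, ⟨x₀, hx₀⟩,
    LevStructure.exists_progression hfB hdf hlastB hgen'⟩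
  have h3 : (A + B).card ≤ ((range (addOrderOf d)).image (fun i => i • d)).card :=
    card_le_card fun z _ => hg.2 z
  have h4 := h3.trans card_image_le
  rw [card_range] at h4
  simp only [dfc] at hd
  omega

/-! ### Unique sums and irreducible pairs -/

/-- `a + b` arises only as the sum of `a` and `b`. -/
structure UniqueSum (A B : Finset G) (a b : G) : Prop where
  mem_left : a ∈ A
  mem_right : b ∈ B
  uniq : ∀ {x y}, x ∈ A → y ∈ B → x + y = a + b → x = a ∧ y = b

/-- A reduction at `(a, b)` by a nonzero proper subgroup exists. -/
def Reducible (A B : Finset G) (a b : G) : Prop :=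
  ∃ H, Red H A B a b ∧ H ≠ {0} ∧ ∃ z, z ∉ H

section WeakPair

variable {A B : Finset G} {a b : G}

theorem Reducible.symm (h : Reducible A B a b) : Reducible B A b a := by
  obtain ⟨H, hr, h0, hz⟩ := h
  exact ⟨H, hr.symm, h0, hz⟩

theorem UniqueSum.symm (h : UniqueSum A B a b) : UniqueSum B A b a where
  mem_left := h.mem_right
  mem_right := h.mem_left
  uniq {x y} hx hy he := (h.uniq hy hx (by rw [add_comm y, he, add_comm])).symm

theorem isAperiodicSet_iff {K : Type*} [AddCommGroup K] {X : Set K} :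
    IsAperiodicSet X ↔ ∀ g : K, g +ᵥ X = X → g = 0 := by
  rw [IsAperiodicSet, AddSubgroup.eq_bot_iff_forall]
  rfl

theorem Aper.isAperiodicSet {X : Finset G} (h : Aper X) : IsAperiodicSet (X : Set G) := by
  rw [isAperiodicSet_iff]
  intro g hg
  refine h g fun x hx => ?_
  have : g +ᵥ x ∈ g +ᵥ (X : Set G) := Set.vadd_mem_vadd_set hx
  rwa [hg] at this

theorem aper_of_isAperiodicSet {X : Finset G} (h : IsAperiodicSet (X : Set G)) : Aper X := by
  rw [isAperiodicSet_iff] at h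
  intro g hg
  refine h g ?_
  have : g +ᵥ X = X := by
    refine eq_of_subset_of_card_le (fun x hx => ?_) (by rw [card_vadd_finset])
    obtain ⟨y, hy, rfl⟩ := mem_vadd_finset.1 hx
    exact hg y hy
  rw [← coe_vadd_finset, this]

theorem UniqueSum.hasUniqueSum (h : UniqueSum A B a b) : HasUniqueSum (A : Set G) (B : Set G) := by
  refine ⟨a + b, ?_⟩
  rw [Set.ncard_eq_one]
  refine ⟨b, Set.eq_singleton_iff_unique_mem.2 ⟨⟨Set.mem_sub.2 ⟨a + b, rfl, a, h.mem_left, ?_⟩,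
    h.mem_right⟩, fun y hy => ?_⟩⟩
  · abel
  · obtain ⟨c, hc, x, hx, he⟩ := Set.mem_sub.1 hy.1
    rw [Set.mem_singleton_iff] at hc
    refine (h.uniq hx hy.2 ?_).2
    rw [← he, hc]
    abel

theorem exists_uniqueSum {c : G} (h : ((({c} : Set G) - A) ∩ B).ncard = 1) :
    ∃ a b, UniqueSum A B a b := by
  obtain ⟨b, hb⟩ := Set.ncard_eq_one.1 h
  have hmem : b ∈ (({c} : Set G) - A) ∩ B := by rw [hb]; rfl
  obtain ⟨c', hc', a, ha, he⟩ := Set.mem_sub.1 hmem.1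
  rw [Set.mem_singleton_iff] at hc'
  subst hc'
  refine ⟨a, b, ha, hmem.2, fun {x y} hx hy hxy => ?_⟩
  have hyb : y = b := by
    have : y ∈ (({c'} : Set G) - A) ∩ B := by
      refine ⟨Set.mem_sub.2 ⟨c', rfl, x, hx, ?_⟩, hy⟩
      rw [← he, add_sub_cancel, ← hxy] at *
      abel
    rwa [hb] at this
  exact ⟨add_right_cancel (hyb ▸ hxy), hyb⟩

theorem weakPair1_of_card (hA : A.Nonempty) (hB : B.Nonempty) (h : A.card = 1 ∨ B.card = 1) :
    WeakPair1 (A : Set G) (B : Set G) := by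
  have := hA.card_pos
  have := hB.card_pos
  rw [WeakPair1, Set.ncard_coe_finset, Set.ncard_coe_finset]
  omega

theorem weakPair4_of_forall_mem (hu : UniqueSum A B a b)
    (hcard : (A + B).card + 1 = A.card + B.card) (h : ∀ z, z ∈ A + B) :
    WeakPair4 (A : Set G) (B : Set G) := by
  have hfin : Finite G := Set.finite_univ_iff.1
    ((A + B).finite_toSet.subset fun z _ => mem_coe.2 (h z))
  have := Fintype.ofFinite G
  refine ⟨⊤, inferInstance, ⟨0, 0, by simp, by simp⟩, ?_, hu.hasUniqueSum⟩
  rw [Set.ncard_coe_finset, Set.ncard_coe_finset, AddSubgroup.card_top, Nat.card_eq_fintype_card,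
    ← card_univ, ← eq_univ_of_forall h, hcard]

theorem weakPair3_of_forall_ne_mem (hap : Aper (A + B))
    (hcard : (A + B).card + 1 = A.card + B.card) {g : G} (hg : g ∉ A + B)
    (h : ∀ z, z ≠ g → z ∈ A + B) : WeakPair3 (A : Set G) (B : Set G) := by
  have hins : ∀ z, z ∈ insert g (A + B) := fun z =>
    mem_insert.2 (or_iff_not_imp_left.2 (h z))
  have hfin : Finite G := Set.finite_univ_iff.1
    ((insert g (A + B)).finite_toSet.subset fun z _ => mem_coe.2 (hins z))
  have := Fintype.ofFinite G
  refine ⟨Aper.isAperiodicSet fun t ht => hap t fun x hx => ?_, ⊤, inferInstance, 0, 0, g,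
    by simp, by simp, ?_⟩
  · obtain ⟨a, ha, b, hb, rfl⟩ := mem_add.1 hx
    rw [← add_assoc]
    exact add_mem_add (ht a ha) hb
  · have hsub : ({g} : Finset G) - B ⊆ Aᶜ := by
      intro x hx
      obtain ⟨c, hc, b, hb, rfl⟩ := mem_sub.1 hx
      rw [mem_singleton] at hc
      subst hc
      rw [mem_compl]
      exact fun hm => hg (mem_add.2 ⟨_, hm, b, hb, by abel⟩)
    have e := eq_of_subset_of_card_le hsub (by
      have h1 := card_insert_of_notMem hg
      rw [eq_univ_of_forall hins, card_univ] at h1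
      rw [card_compl, singleton_sub, card_image_of_injective _ sub_right_injective]
      omega)
    have e2 := congrArg (fun X : Finset G => (X : Set G)) e
    simp only [coe_sub, coe_singleton, coe_compl] at e2
    rw [e2]
    ext x
    simp

theorem weakPair2_of_progressions {d x₀ y₀ : G}
    (hd : addOrderOf d = 0 ∨ A.card + B.card - 1 ≤ addOrderOf d)
    (hA : A = (range A.card).image fun i => x₀ + i • d)
    (hB : B = (range B.card).image fun i => y₀ + i • d) : WeakPair2 (A : Set G) (B : Set G) := by
  have key : ∀ {X : Finset G} {x : G}, (X = (range X.card).image fun i => x + i • d) →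
      IsArithProgression d (X : Set G) := by
    intro X x hX
    refine ⟨x, ?_⟩
    rw [Set.ncard_coe_finset]
    ext z
    rw [mem_coe, Set.mem_ofPred_eq]
    conv_lhs => rw [hX]
    simp only [mem_image, mem_range, eq_comm]
  refine ⟨d, ?_, key hA, key hB⟩
  rwa [Set.ncard_coe_finset, Set.ncard_coe_finset]

/-- A unique sum inside a periodic sumset yields a reduction. -/
theorem UniqueSum.reducible_of_not_aper (hu : UniqueSum A B a b)
    (hcard : (A + B).card + 1 = A.card + B.card) (hap : ¬ Aper (A + B)) {z : G}
    (hz : z ∉ A + B) : Reducible A B a b := by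
  obtain ⟨S, hS, hpS, hg, hle⟩ := kneser ⟨a, hu.mem_left⟩ ⟨b, hu.mem_right⟩
  have hS0 : S ≠ {0} := by
    rintro rfl
    refine hap fun g hg' => ?_
    simpa using hg g hg'
  -- By uniqueness, x ↦ a + b - x sends the points x ≠ a of A ∩ (a + S) into (b + S) \ B. The
  -- resulting bound forces equality in Kneser's inequality.
  have hsmall : (A ∩ coset S a).card + (B ∩ coset S b).card ≤ S.card + 1 := by
    have hsub : ((A ∩ coset S a).erase a).image (a + b - ·) ⊆ coset S b \ (B ∩ coset S b) := by
      intro y hy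
      obtain ⟨x, hx, rfl⟩ := mem_image.1 hy
      rw [mem_erase, mem_inter] at hx
      refine mem_sdiff.2 ⟨?_, fun hc => hx.1 (hu.uniq hx.2.1 (mem_inter.1 hc).1 (by abel)).1⟩
      have := hS.neg (mem_coset.1 hx.2.2)
      rw [mem_coset]
      rwa [show -(x - a) = a + b - x - b by abel] at this
    have h1 := card_le_card hsub
    rw [card_image_of_injective _ sub_right_injective] at h1
    have h2 := card_erase_add_one (mem_inter.2 ⟨hu.mem_left, hS.self_mem_coset a⟩)
    have h3 := card_sdiff_add_card_eq_card (s := B ∩ coset S b) (t := coset S b) inter_subset_right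
    rw [card_coset] at h3
    omega
  have c1 := card_sdiff_coset_add hS hu.mem_left
  have c2 := card_sdiff_coset_add hS hu.mem_right
  have c3 := card_inter_add_card_sdiff A (coset S a)
  have c4 := card_inter_add_card_sdiff B (coset S b)
  have c5 := card_le_card_add hS (A \ coset S a)
  have c6 := card_le_card_add hS (B \ coset S b)
  have pA : Per S (A \ coset S a) := per_of_card_le hS (by omega)
  have pB : Per S (B \ coset S b) := per_of_card_le hS (by omega)
  have huniq : ∀ {x y}, x ∈ A → y ∈ B → x + y ∈ coset S (a + b) →
      x ∈ coset S a ∧ y ∈ coset S b := by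
    intro x y hx hy hxy
    have hxa : x ∈ coset S a := by
      by_contra hxa
      have := pA _ (hS.neg (mem_coset.1 hxy)) x (mem_sdiff.2 ⟨hx, hxa⟩)
      have h2 := (hu.uniq (mem_sdiff.1 this).1 hy (by abel)).1
      rw [h2] at this
      exact (mem_sdiff.1 this).2 (hS.self_mem_coset a)
    refine ⟨hxa, mem_coset.2 ?_⟩
    have := hS.sub (mem_coset.1 hxy) (mem_coset.1 hxa)
    rwa [show x + y - (a + b) - (x - a) = y - b by abel] at this
  refine ⟨S, ⟨hS, hu.mem_left, hu.mem_right, pA, pB, huniq, ?_⟩, hS0, z - (a + b), fun hc => ?_⟩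
  · have e : A ∩ coset S a + B ∩ coset S b = coset S (a + b) := by
      apply Subset.antisymm
      · intro w hw
        obtain ⟨x, hx, y, hy, rfl⟩ := mem_add.1 hw
        have := hS.add (mem_coset.1 (mem_inter.1 hx).2) (mem_coset.1 (mem_inter.1 hy).2)
        rw [mem_coset]
        rwa [show x - a + (y - b) = x + y - (a + b) by abel] at this
      · intro w hw
        obtain ⟨x, hx, y, hy, rfl⟩ :=
          mem_add.1 (hpS.coset_subset (add_mem_add hu.mem_left hu.mem_right) hw)
        have := huniq hx hy hw
        exact add_mem_add (mem_inter.2 ⟨hx, this.1⟩) (mem_inter.2 ⟨hy, this.2⟩)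
    rw [e, card_coset]
    omega
  · have := hpS _ hc _ (add_mem_add hu.mem_left hu.mem_right)
    rw [sub_add_cancel] at this
    exact hz this

/-- The full coset b + H lies in B, so uniqueness isolates a in its H-coset, which must be a' + H.
Hence A \ {a} is H-periodic, and `red_of_erase` applies with the roles of A and B exchanged. -/
theorem UniqueSum.reducible_of_notMem_coset {H : Finset G} {a' b' : G} (hu : UniqueSum A B a b)
    (hd : dfc A B = 1) (h2 : 2 ≤ A.card) (hr : Red H A B a' b') (h0 : H ≠ {0})
    (hb : b ∉ coset H b') : Reducible A B a b := by
  have hH := hr.finSub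
  have hA : ∀ x ∈ A, x ∈ coset H a → x = a := by
    intro x hx hxa
    have := hr.per_right _ (hH.neg (mem_coset.1 hxa)) b (mem_sdiff.2 ⟨hu.mem_right, hb⟩)
    exact (hu.uniq hx (mem_sdiff.1 this).1 (by abel)).1
  have ha : a ∈ coset H a' := by
    by_contra ha
    obtain ⟨t, ht, ht0⟩ := hH.exists_ne_zero h0
    have := hr.per_left t ht a (mem_sdiff.2 ⟨hu.mem_left, ha⟩)
    have := hA _ (mem_sdiff.1 this).1 (mem_coset.2 (by simpa using ht))
    exact ht0 (by simpa using this)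
  have e : A \ coset H a' = A.erase a := by
    rw [← hH.coset_eq ha]
    ext x
    rw [mem_sdiff, mem_erase]
    refine ⟨fun h => ⟨?_, h.1⟩, fun h => ⟨h.2, fun hc => h.1 (hA x h.2 hc)⟩⟩
    rintro rfl
    exact h.2 (hH.self_mem_coset x)
  have hper := hr.per_left
  rw [e] at hper
  have hne : (A.erase a).Nonempty := by
    have := card_erase_add_one hu.mem_left
    exact card_pos.1 (by omega)
  obtain ⟨K, hK, hK0, hz, -⟩ := red_of_erase (A := B) (B := A) (by rwa [dfc_comm]) hu.mem_right
    hu.mem_left hne (fun hc => by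
      obtain ⟨y, hy, x, hx, he⟩ := mem_add.1 hc
      rw [mem_erase] at hx
      exact hx.1 (hu.uniq hx.2 hy (by rw [add_comm x, he, add_comm])).1)
    (fun hap => h0 (hap.eq_bot hH (hper.add_right B)))
  exact ⟨K, hK.symm, hK0, hz⟩

/-- Keeps the exceptional cosets of successive reductions over one base point, so that their
quasi-periodicities compose. -/
theorem UniqueSum.reducible_of_reducible {a' b' : G} (hu : UniqueSum A B a b)
    (hd : dfc A B = 1) (h2 : 2 ≤ A.card) (h2' : 2 ≤ B.card) (hr : Reducible A B a' b') :
    Reducible A B a b := by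
  obtain ⟨H, hr, h0, hz⟩ := hr
  have hH := hr.finSub
  by_cases hb : b ∈ coset H b'
  · by_cases ha : a ∈ coset H a'
    · refine ⟨H, ⟨hH, hu.mem_left, hu.mem_right, ?_, ?_, fun {x y} hx hy hxy => ?_, ?_⟩, h0, hz⟩
      · rw [hH.coset_eq ha]
        exact hr.per_left
      · rw [hH.coset_eq hb]
        exact hr.per_right
      · rw [hH.coset_eq ha, hH.coset_eq hb]
        refine hr.uniq hx hy (hH.coset_trans hxy (mem_coset.2 ?_))
        have := hH.add (mem_coset.1 ha) (mem_coset.1 hb)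
        rwa [show a - a' + (b - b') = a + b - (a' + b') by abel] at this
      · rw [hH.coset_eq ha, hH.coset_eq hb]
        exact hr.card
    · exact (hu.symm.reducible_of_notMem_coset (by rwa [dfc_comm]) h2' hr.symm h0 ha).symm
  · exact hu.reducible_of_notMem_coset hd h2 hr h0 hb

/-- An aperiodic critical pair has a reduction or is a weak pair. -/
theorem reducible_or_isWeakPair_of_aper (hA : A.Nonempty) (hB : B.Nonempty)
    (hcard : (A + B).card + 1 = A.card + B.card) (hap : Aper (A + B)) :
    (2 ≤ A.card ∧ 2 ≤ B.card ∧ ∃ a b, Reducible A B a b) ∨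
      IsWeakPair (A : Set G) (B : Set G) := by
  by_cases h1 : A.card = 1 ∨ B.card = 1
  · exact Or.inr (Or.inl (weakPair1_of_card hA hB h1))
  have hA2 : 2 ≤ A.card := by
    have := hA.card_pos
    omega
  have hB2 : 2 ≤ B.card := by
    have := hB.card_pos
    omega
  -- If A + B were G, every element would be a period.
  obtain ⟨g, hg⟩ : ∃ g, g ∉ A + B := by
    by_contra! hc
    obtain ⟨x, -, y, -, hxy⟩ := one_lt_card.1 hA2
    exact hxy (sub_eq_zero.1 (hap _ fun w _ => hc _))
  by_cases h3 : ∀ z, z ≠ g → z ∈ A + B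
  · exact Or.inr (Or.inr (Or.inr (Or.inl (weakPair3_of_forall_ne_mem hap hcard hg h3))))
  · push Not at h3
    obtain ⟨u, hug, hu⟩ := h3
    by_cases hr : ∃ a b, Reducible A B a b
    · exact Or.inl ⟨hA2, hB2, hr⟩
    · have hc : Crit A B := by
        refine ⟨hap, ?_, hA2, hB2, fun H a b hr' h0 z => ?_⟩
        · simp only [dfc]
          omega
        · by_contra hz
          exact hr ⟨a, b, H, hr', h0, z, hz⟩
      obtain ⟨d, hd, ⟨x₀, hx⟩, y₀, hy⟩ := hc.exists_progression hug hu hg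
      exact Or.inr (Or.inr (Or.inl (weakPair2_of_progressions hd hx hy)))

theorem UniqueSum.reducible_or_isWeakPair (hu : UniqueSum A B a b)
    (hcard : (A + B).card + 1 = A.card + B.card) :
    (2 ≤ A.card ∧ 2 ≤ B.card ∧ Reducible A B a b) ∨ IsWeakPair (A : Set G) (B : Set G) := by
  have hA : A.Nonempty := ⟨a, hu.mem_left⟩
  have hB : B.Nonempty := ⟨b, hu.mem_right⟩
  by_cases h1 : A.card = 1 ∨ B.card = 1
  · exact Or.inr (Or.inl (weakPair1_of_card hA hB h1))
  have hA2 : 2 ≤ A.card := by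
    have := hA.card_pos
    omega
  have hB2 : 2 ≤ B.card := by
    have := hB.card_pos
    omega
  by_cases h4 : ∀ z, z ∈ A + B
  · exact Or.inr (Or.inr (Or.inr (Or.inr (weakPair4_of_forall_mem hu hcard h4))))
  push Not at h4
  obtain ⟨z, hz⟩ := h4
  by_cases hap : Aper (A + B)
  · rcases reducible_or_isWeakPair_of_aper hA hB hcard hap with ⟨-, -, a', b', hr⟩ | hw
    · refine Or.inl ⟨hA2, hB2, hu.reducible_of_reducible ?_ hA2 hB2 hr⟩
      simp only [dfc]
      omega
    · exact Or.inr hw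
  · exact Or.inl ⟨hA2, hB2, hu.reducible_of_not_aper hcard hap hz⟩

end WeakPair

-- Passage to quotients and induction

universe u

/-- The subgroup with the elements of `T`. -/
def FinSub.toAddSubgroup {T : Finset G} (hT : FinSub T) : AddSubgroup G where
  carrier := T
  zero_mem' := hT.zero
  add_mem' := hT.add
  neg_mem' := hT.neg

theorem FinSub.mk_eq_mk {T : Finset G} (hT : FinSub T) {x y : G} :
    (QuotientAddGroup.mk' hT.toAddSubgroup x = QuotientAddGroup.mk' hT.toAddSubgroup y) ↔
      x ∈ coset T y := by
  rw [eq_comm, QuotientAddGroup.mk'_apply, QuotientAddGroup.mk'_apply, QuotientAddGroup.eq,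
    mem_coset, neg_add_eq_sub]
  rfl

theorem card_add_eq_card_image_mul {Q : Type*} [DecidableEq Q] {T : Finset G} (f : G → Q)
    (hf : ∀ {x y}, f x = f y ↔ x ∈ coset T y) (hT : FinSub T) (X : Finset G) :
    (X + T).card = (X.image f).card * T.card := by
  have e : (X + T).image f = X.image f := by
    ext q
    simp only [mem_image]
    constructor
    · rintro ⟨_, hz, rfl⟩
      obtain ⟨x, hx, t, ht, rfl⟩ := mem_add.1 hz
      exact ⟨x, hx, hf.2 (hT.coset_comm (mem_coset.2 (by simpa using ht)))⟩
    · rintro ⟨x, hx, rfl⟩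
      exact ⟨x, subset_add hT hx, rfl⟩
  rw [card_eq_sum_card_image f, e, sum_const_nat]
  intro q hq
  obtain ⟨x, hx, rfl⟩ := mem_image.1 hq
  rw [← card_coset T x]
  congr 1
  ext y
  rw [mem_filter, hf]
  exact ⟨fun h => h.2, fun h => ⟨coset_subset_add hx h, h⟩⟩

section Red

variable {A B H : Finset G} {a b : G}

/-- Outside the distinguished cosets everything is a union of H-cosets; inside, each critical part
fills out to one coset. Division by |H| gives criticality of the images. -/
theorem Red.card_add (h : Red H A B a b) (hcard : (A + B).card + 1 = A.card + B.card) :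
    (A + B + H).card + H.card = (A + H).card + (B + H).card := by
  have hH := h.finSub
  have hp : Per H ((A + B) \ coset H (a + b)) := by
    intro t ht z hz
    rw [mem_sdiff] at hz ⊢
    refine ⟨?_, fun hc => hz.2 ?_⟩
    · obtain ⟨x, hx, y, hy, rfl⟩ := mem_add.1 hz.1
      by_cases hxa : x ∈ coset H a
      · by_cases hyb : y ∈ coset H b
        · refine absurd (mem_coset.2 ?_) hz.2
          have := hH.add (mem_coset.1 hxa) (mem_coset.1 hyb)
          rwa [show x - a + (y - b) = x + y - (a + b) by abel] at this
        · have := h.per_right t ht y (mem_sdiff.2 ⟨hy, hyb⟩)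
          exact mem_add.2 ⟨x, hx, _, (mem_sdiff.1 this).1, by abel⟩
      · have := h.per_left t ht x (mem_sdiff.2 ⟨hx, hxa⟩)
        exact mem_add.2 ⟨_, (mem_sdiff.1 this).1, y, hy, by abel⟩
    · have := hH.add (hH.neg ht) (mem_coset.1 hc)
      rw [mem_coset]
      rwa [show -t + (t + z - (a + b)) = z - (a + b) by abel] at this
  have e : (A + B) ∩ coset H (a + b) = A ∩ coset H a + B ∩ coset H b := by
    ext z
    rw [mem_inter]
    constructor
    · rintro ⟨hz, hzc⟩
      obtain ⟨x, hx, y, hy, rfl⟩ := mem_add.1 hz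
      have := h.uniq hx hy hzc
      exact add_mem_add (mem_inter.2 ⟨hx, this.1⟩) (mem_inter.2 ⟨hy, this.2⟩)
    · intro hz
      obtain ⟨x, hx, y, hy, rfl⟩ := mem_add.1 hz
      rw [mem_inter] at hx hy
      refine ⟨add_mem_add hx.1 hy.1, mem_coset.2 ?_⟩
      have := hH.add (mem_coset.1 hx.2) (mem_coset.1 hy.2)
      rwa [show x - a + (y - b) = x + y - (a + b) by abel] at this
  have c1 := card_sdiff_coset_add hH h.mem_left
  have c2 := card_sdiff_coset_add hH h.mem_right
  have c3 := card_sdiff_coset_add hH (add_mem_add h.mem_left h.mem_right)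
  rw [h.per_left.add_eq hH] at c1
  rw [h.per_right.add_eq hH] at c2
  rw [hp.add_eq hH] at c3
  have c4 := card_inter_add_card_sdiff A (coset H a)
  have c5 := card_inter_add_card_sdiff B (coset H b)
  have c6 := card_inter_add_card_sdiff (A + B) (coset H (a + b))
  rw [e] at c6
  have := h.card
  omega

theorem Red.card_image_lt {Q : Type*} [DecidableEq Q] (h : Red H A B a b) (h0 : H ≠ {0})
    (h2 : 2 ≤ A.card) (f : G → Q) (hf : ∀ {x y}, f x = f y ↔ x ∈ coset H y) :
    (A.image f).card < A.card := by
  have hH := h.finSub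
  have c0 := card_add_eq_card_image_mul f hf hH A
  have c1 := card_sdiff_coset_add hH h.mem_left
  rw [h.per_left.add_eq hH] at c1
  have c2 := card_inter_add_card_sdiff A (coset H a)
  have c3 : 0 < (A ∩ coset H a).card :=
    card_pos.2 ⟨a, mem_inter.2 ⟨h.mem_left, hH.self_mem_coset a⟩⟩
  have c4 := hH.two_le_card h0
  by_contra! hle
  have := Nat.mul_le_mul_right H.card hle
  obtain ⟨p, hp⟩ := Nat.exists_eq_add_of_le h2
  obtain ⟨q, hq⟩ := Nat.exists_eq_add_of_le c4
  rw [hp, hq] at this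
  nlinarith

end Red

/-- `A` contains every fibre of `f` that it meets, except perhaps the fibre of `a`. -/
def FiberFullAway {Q : Type*} (f : G → Q) (A : Finset G) (a : G) : Prop :=
  ∀ x ∈ A, f x ≠ f a → ∀ y, f y = f x → y ∈ A

/-- The fibre of a under the composite contains a + H, so the other fibres avoid the only H-coset
where A may be incomplete. -/
theorem FiberFullAway.comp {Q Q' : Type*} [DecidableEq Q] {A H : Finset G} {a : G} (f : G → Q)
    (hf : ∀ {x y}, f x = f y ↔ x ∈ coset H y) (g : Q → Q') (hp : Per H (A \ coset H a))
    (hg : ∀ q ∈ A.image f, g q ≠ g (f a) → ∀ p, g p = g q → p ∈ A.image f) :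
    FiberFullAway (g ∘ f) A a := by
  intro x hx hxa y hy
  obtain ⟨w, hw, he⟩ := mem_image.1 (hg _ (mem_image_of_mem f hx) hxa _ hy)
  have hwa : w ∉ coset H a := by
    intro hc
    refine hxa ?_
    have : f w = f a := hf.2 hc
    rw [← hy, Function.comp_apply, ← he, this]
    rfl
  have := hp _ (mem_coset.1 (hf.1 he.symm)) w (mem_sdiff.2 ⟨hw, hwa⟩)
  rw [sub_add_cancel] at this
  exact (mem_sdiff.1 this).1

/-- The conclusion of the structure theorem, for a surjective homomorphism with finite kernel. -/
def HasWeakImage {G : Type u} [AddCommGroup G] (A B : Finset G) (a b : G) : Prop :=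
  ∃ (Q : Type u) (_ : AddCommGroup Q) (f : G →+ Q), Function.Surjective f ∧
    (f.ker : Set G).Finite ∧ (∃ x, f x ≠ 0) ∧ FiberFullAway f A a ∧ FiberFullAway f B b ∧
      IsWeakPair (f '' A) (f '' B)

theorem HasWeakImage.of_isWeakPair {G : Type u} [AddCommGroup G] [Nontrivial G] {A B : Finset G}
    (a b : G) (h : IsWeakPair (A : Set G) (B : Set G)) : HasWeakImage A B a b := by
  refine ⟨G, inferInstance, AddMonoidHom.id G, Function.surjective_id, ?_, exists_ne 0,
    fun x hx _ y hy => ?_, fun x hx _ y hy => ?_, ?_⟩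
  · rw [AddMonoidHom.ker_id]
    exact Set.finite_singleton 0
  · rwa [show y = x from hy]
  · rwa [show y = x from hy]
  · rwa [AddMonoidHom.coe_id, Set.image_id, Set.image_id]

theorem Red.hasWeakImage {G : Type u} [AddCommGroup G] [DecidableEq G] {A B H : Finset G}
    {a b : G} (h : Red H A B a b) (h0 : H ≠ {0}) (hz : ∃ z, z ∉ H)
    (hcard : (A + B).card + 1 = A.card + B.card) (h2 : 2 ≤ A.card) (h2' : 2 ≤ B.card)
    (ih : ∀ (Q : Type u) [AddCommGroup Q] [Nontrivial Q] [DecidableEq Q] (X Y : Finset Q) (x y : Q),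
      X.card + Y.card < A.card + B.card → UniqueSum X Y x y →
        (X + Y).card + 1 = X.card + Y.card → HasWeakImage X Y x y) :
    HasWeakImage A B a b := by
  classical
  have hH := h.finSub
  let f := QuotientAddGroup.mk' hH.toAddSubgroup
  have hf : ∀ {x y}, f x = f y ↔ x ∈ coset H y := hH.mk_eq_mk
  obtain ⟨z, hz⟩ := hz
  have hfz : f z ≠ f 0 := fun hc => hz (by simpa [mem_coset] using hf.1 hc)
  have : Nontrivial (G ⧸ hH.toAddSubgroup) := ⟨f z, f 0, hfz⟩
  have hu : UniqueSum (A.image f) (B.image f) (f a) (f b) := by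
    refine ⟨mem_image_of_mem f h.mem_left, mem_image_of_mem f h.mem_right, fun {p q} hp hq he => ?_⟩
    obtain ⟨x, hx, rfl⟩ := mem_image.1 hp
    obtain ⟨y, hy, rfl⟩ := mem_image.1 hq
    rw [← map_add, ← map_add] at he
    have := h.uniq hx hy (hf.1 he)
    exact ⟨hf.2 this.1, hf.2 this.2⟩
  have c1 := h.card_add hcard
  rw [card_add_eq_card_image_mul f hf hH, card_add_eq_card_image_mul f hf hH A,
    card_add_eq_card_image_mul f hf hH B, image_add f] at c1
  have c2 : (A.image f + B.image f).card + 1 = (A.image f).card + (B.image f).card := by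
    refine Nat.eq_of_mul_eq_mul_right hH.card_pos ?_
    rw [add_mul, add_mul, one_mul, c1]
  have l1 := h.card_image_lt h0 h2 f hf
  have l2 := h.symm.card_image_lt h0 h2' f hf
  obtain ⟨Q, hQ, g, hg, hker, ⟨q, hq⟩, qA, qB, hw⟩ := ih _ _ _ _ _ (by omega) hu c2
  obtain ⟨x, rfl⟩ := QuotientAddGroup.mk'_surjective _ q
  refine ⟨Q, hQ, g.comp f, hg.comp (QuotientAddGroup.mk'_surjective _), ?_, ⟨x, hq⟩,
    FiberFullAway.comp f hf g h.per_left qA, FiberFullAway.comp f hf g h.per_right qB, ?_⟩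
  · have hpre := Set.Finite.preimage' (f := f) hker fun q _ => by
      obtain ⟨y, rfl⟩ := QuotientAddGroup.mk'_surjective _ q
      exact (coset H y).finite_toSet.subset fun w hw => mem_coe.2 (hf.1 hw)
    exact hpre
  · rw [coe_image, coe_image] at hw
    rwa [AddMonoidHom.coe_comp, Set.image_comp, Set.image_comp]

theorem UniqueSum.hasWeakImage (n : ℕ) : ∀ (G : Type u) [AddCommGroup G] [Nontrivial G]
    [DecidableEq G] (A B : Finset G) (a b : G), A.card + B.card = n → UniqueSum A B a b →
      (A + B).card + 1 = A.card + B.card → HasWeakImage A B a b := by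
  induction n using Nat.strong_induction_on with
  | _ n ih =>
    intro G _ _ _ A B a b hn hu hcard
    rcases hu.reducible_or_isWeakPair hcard with ⟨h2, h2', H, hr, h0, hz⟩ | hw
    · exact hr.hasWeakImage h0 hz hcard h2 h2' fun Q _ _ _ X Y x y hlt =>
        ih _ (hn ▸ hlt) Q X Y x y rfl
    · exact .of_isWeakPair a b hw

/-- In the aperiodic case the first reduction creates a unique sum in the quotient, and the
induction for unique sums takes over. -/
theorem exists_hasWeakImage {G : Type u} [AddCommGroup G] [Nontrivial G] [DecidableEq G]
    {A B : Finset G} (hA : A.Nonempty) (hB : B.Nonempty)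
    (hcard : (A + B).card + 1 = A.card + B.card)
    (h : Aper (A + B) ∨ ∃ a b, UniqueSum A B a b) : ∃ a b, HasWeakImage A B a b := by
  rcases h with hap | ⟨a, b, hu⟩
  · rcases reducible_or_isWeakPair_of_aper hA hB hcard hap with
      ⟨h2, h2', a, b, H, hr, h0, hz⟩ | hw
    · exact ⟨a, b, hr.hasWeakImage h0 hz hcard h2 h2' fun Q _ _ _ X Y x y _ =>
        UniqueSum.hasWeakImage _ Q X Y x y rfl⟩
    -- The identity has one-point fibres, so any base points serve.
    · exact ⟨0, 0, .of_isWeakPair 0 0 hw⟩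
  · exact ⟨a, b, UniqueSum.hasWeakImage _ G A B a b rfl hu hcard⟩

/-! ### Transport to the quotient by the kernel -/

section Transport

variable {P Q : Type*} [AddCommGroup P] [AddCommGroup Q] (e : P ≃+ Q) {X Y : Set P}

theorem ncard_image_addEquiv (X : Set P) : (e '' X).ncard = X.ncard :=
  Set.ncard_image_of_injective X e.injective

theorem image_vadd_addSubgroup (a : P) (F : AddSubgroup P) :
    e '' (a +ᵥ (F : Set P)) = e a +ᵥ ((F.map e.toAddMonoidHom : AddSubgroup Q) : Set Q) := by
  ext q
  constructor
  · rintro ⟨_, ⟨x, hx, rfl⟩, rfl⟩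
    exact ⟨e x, ⟨x, hx, rfl⟩, (map_add e a x).symm⟩
  · rintro ⟨_, ⟨x, hx, rfl⟩, rfl⟩
    exact ⟨a + x, ⟨x, hx, rfl⟩, map_add e a x⟩

theorem image_singleton_sub (c : P) (X : Set P) :
    e '' ({c} - X) = {e c} - e '' X := by
  rw [Set.image_sub, Set.image_singleton]

theorem _root_.HasUniqueSum.image (h : HasUniqueSum X Y) : HasUniqueSum (e '' X) (e '' Y) := by
  obtain ⟨c, hc⟩ := h
  refine ⟨e c, ?_⟩
  rwa [← image_singleton_sub, ← Set.image_inter e.injective, ncard_image_addEquiv]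

theorem _root_.IsAperiodicSet.image (h : IsAperiodicSet X) : IsAperiodicSet (e '' X) := by
  rw [isAperiodicSet_iff] at h ⊢
  intro g hg
  obtain ⟨p, rfl⟩ := e.surjective g
  rw [h p ?_, map_zero]
  refine e.injective.image_injective ?_
  rw [← hg]
  ext q
  constructor
  · rintro ⟨_, ⟨x, hx, rfl⟩, rfl⟩
    exact ⟨e x, ⟨x, hx, rfl⟩, (map_add e p x).symm⟩
  · rintro ⟨_, ⟨x, hx, rfl⟩, rfl⟩
    exact ⟨p + x, ⟨x, hx, rfl⟩, map_add e p x⟩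

theorem _root_.IsArithProgression.image {d : P} (h : IsArithProgression d X) :
    IsArithProgression (e d) (e '' X) := by
  obtain ⟨a, ha⟩ := h
  refine ⟨e a, ?_⟩
  rw [ncard_image_addEquiv]
  conv_lhs => rw [ha]
  ext q
  constructor
  · rintro ⟨_, ⟨i, hi, rfl⟩, rfl⟩
    exact ⟨i, hi, by simp⟩
  · rintro ⟨i, hi, rfl⟩
    exact ⟨_, ⟨i, hi, rfl⟩, by simp⟩

theorem _root_.IsWeakPair.image (h : IsWeakPair X Y) : IsWeakPair (e '' X) (e '' Y) := by
  rcases h with h | ⟨d, hd, hX, hY⟩ | ⟨hap, F, hF, a, b, g, hX, hY, hg⟩ |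
    ⟨F, hF, ⟨a, b, hX, hY⟩, hcard, hu⟩
  · left
    rwa [WeakPair1, ncard_image_addEquiv, ncard_image_addEquiv]
  · right; left
    refine ⟨e d, ?_, hX.image e, hY.image e⟩
    rwa [ncard_image_addEquiv, ncard_image_addEquiv, AddEquiv.addOrderOf_eq]
  · right; right; left
    refine ⟨hap.image e, F.map e.toAddMonoidHom, Set.Finite.image e hF, e a, e b, e g, ?_, ?_, ?_⟩
    · rw [← image_vadd_addSubgroup]
      exact Set.image_mono hX
    · rw [← image_vadd_addSubgroup]
      exact Set.image_mono hY
    · rw [← image_vadd_addSubgroup, ← image_singleton_sub, hg, Set.image_sdiff e.injective]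
  · right; right; right
    refine ⟨F.map e.toAddMonoidHom, Set.Finite.image e hF, ⟨e a, e b, ?_, ?_⟩, ?_, hu.image e⟩
    · rw [← image_vadd_addSubgroup]
      exact Set.image_mono hX
    · rw [← image_vadd_addSubgroup]
      exact Set.image_mono hY
    · rw [ncard_image_addEquiv, ncard_image_addEquiv, hcard]
      congr 1
      exact (ncard_image_addEquiv e (F : Set P)).symm

end Transport

theorem FiberFullAway.isQuasiPeriodic {Q : Type*} [AddCommGroup Q] {A : Finset G} {a : G}
    (f : G →+ Q) (h : FiberFullAway f A a) : IsQuasiPeriodic f.ker (A : Set G) := by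
  have hmem : ∀ x, x ∈ a +ᵥ (f.ker : Set G) ↔ f x = f a := by
    intro x
    rw [Set.mem_vadd_set_iff_neg_vadd_mem, vadd_eq_add, SetLike.mem_coe, AddMonoidHom.mem_ker,
      map_add, map_neg, neg_add_eq_zero, eq_comm]
  refine ⟨a, Set.Subset.antisymm ?_ fun x hx => Set.mem_add.2 ⟨x, hx, 0, zero_mem _, add_zero x⟩⟩
  intro z hz
  obtain ⟨x, ⟨hx, hxa⟩, k, hk, rfl⟩ := Set.mem_add.1 hz
  rw [hmem] at hxa
  have e : f (x + k) = f x := by rw [map_add, AddMonoidHom.mem_ker.1 hk, add_zero]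
  refine ⟨h x hx hxa _ e, ?_⟩
  rwa [hmem, e]

theorem HasWeakImage.exists_addSubgroup {G : Type u} [AddCommGroup G] {A B : Finset G} {a b : G}
    (h : HasWeakImage A B a b) : ∃ H : AddSubgroup G, Finite H ∧ H ≠ ⊤ ∧
      IsQuasiPeriodic H (A : Set G) ∧ IsQuasiPeriodic H (B : Set G) ∧
      IsWeakPair ((QuotientAddGroup.mk' H) '' (A : Set G))
        ((QuotientAddGroup.mk' H) '' (B : Set G)) := by
  classical
  obtain ⟨Q, _, f, hf, hker, ⟨x, hx⟩, qA, qB, hw⟩ := h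
  refine ⟨f.ker, hker, fun hc => hx ?_, qA.isQuasiPeriodic f, qB.isQuasiPeriodic f, ?_⟩
  · rw [← AddMonoidHom.mem_ker, hc]
    trivial
  · let e := QuotientAddGroup.quotientKerEquivOfSurjective f hf
    have key : ∀ X : Set G, e.symm '' (f '' X) = (QuotientAddGroup.mk' f.ker) '' X := by
      intro X
      rw [← Set.image_comp]
      refine Set.image_congr fun y _ => ?_
      rw [Function.comp_apply, AddEquiv.symm_apply_eq]
      rfl
    rw [← key, ← key]
    exact hw.image e.symm

end LevStructure

theorem mainTheorem5 {G : Type*} [AddCommGroup G] [Nontrivial G] (A B : Set G)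
    (hAfin : A.Finite) (hBfin : B.Finite) (hA : A.Nonempty) (hB : B.Nonempty)
    (hle : A.ncard ≤ B.ncard)
    (hcard : (A + B).ncard = A.ncard + B.ncard - 1)
    (hAB : IsAperiodicSet (A + B) ∨ ∃ c : G, ((({c} : Set G) - A) ∩ B).ncard = 1) :
    ∃ H : AddSubgroup G, Finite H ∧ H ≠ ⊤ ∧
      IsQuasiPeriodic H A ∧ IsQuasiPeriodic H B ∧
      IsWeakPair ((QuotientAddGroup.mk' H) '' A) ((QuotientAddGroup.mk' H) '' B) := by
  classical
  lift A to Finset G using hAfin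
  lift B to Finset G using hBfin
  rw [Finset.coe_nonempty] at hA hB
  rw [← Finset.coe_add] at hcard hAB
  simp only [Set.ncard_coe_finset] at hcard
  obtain ⟨a, b, h⟩ := LevStructure.exists_hasWeakImage hA hB (by have := hA.card_pos; omega)
    (hAB.imp LevStructure.aper_of_isAperiodicSet fun ⟨_, hc⟩ => LevStructure.exists_uniqueSum hc)
  exact h.exists_addSubgroup
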